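/- Let $n\in\mathbb N$, $T>0$, and consider a third order operator on $[0,T]\times\mathbb R^n$ with symbol $\tau^3+\sum_{j\le 2}\sum_{|\alpha|\le 3-j}a_{j,\alpha}(t)\tau^j\xi^\alpha$, and put $$L(t,\tau,\xi)=\tau^3+\sum_{j\le 2,\ j+|\alpha|=3}a_{j,\alpha}(t)\tau^j\xi^\alpha,\qquad M(t,\tau,\xi)=\sum_{j+|\alpha|=2}a_{j,\alpha}(t)\tau^j\xi^\alpha ,$$ where the (complex-valued) coefficients of $L$ and $M$ are real-analytic in a neighbourhood of $[0,T]$. Assume that for all $(t,\xi)\in[0,T]\times\mathbb R^n$ the polynomial $L(t,\cdot,\xi)$ has only real roots $\tau_1(t,\xi),\tau_2(t,\xi),\tau_3(t,\xi)$, listed with multiplicity but not necessarily in increasing order. Set $$\check M=M-\tfrac12\partial_t\partial_\tau L,\qquad \Delta_L^{(1)}=(\tau_1-\tau_2)^2+(\tau_2-\tau_3)^2+(\tau_3-\tau_1)^2,\qquad \mathcal L=L-\partial_\tau^2L ,$$ and let $\lambda_1,\lambda_2,\lambda_3$ be the roots in $\tau$ of $\mathcal L(t,\tau,\xi)$. Condition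 (E-Mcl) is the following: for every $R>0$ there is $C>0$ such that for all $\xi\in\mathbb R^n$ with $|\xi|\ge R$ $$\int_0^T\ \sum_{(j,k,l)\in\{(1,2,3),(2,3,1),(3,1,2)\}}\frac{|\check M(t,\lambda_j(t,\xi),\xi)|}{|\lambda_j(t,\xi)-\lambda_k(t,\xi)|\,|\lambda_j(t,\xi)-\lambda_l(t,\xi)|}\,dt\ \le\ C\log(1+|\xi|),$$ the integrand being integrable. Suppose that $\tau_1\equiv\tau_2$ and $\tau_3\not\equiv\tau_1$ on $[0,T]\times\mathbb R^n$. Consider the conditions (a) $\check M(t,\tau_1(t,\xi),\xi)=0$ for all $(t,\xi)\in[0,T]\times\mathbb R^n$; (b) with $Q(t,\tau,\xi)=\check M(t,\tau,\xi)/(\tau-\tau_1(t,\xi))$ (quotient of polynomials in $\tau$), there is $C>0$ such that, for $j=1,3$, $$|Q(t,\tau_j(t,\xi),\xi)|\le C\Bigl(\sqrt{\Delta_L^{(1)}(t,\xi)}+\bigl|\partial_t\sqrt{\Delta_L^{(1)}(t,\xi)}\bigr|\Bigr)$$ at all $(t,\xi)\in[0,T]\times\mathbb R^n$ at which the derivative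 exists (one-sided for $t=0$ and $t=T$). If (a) and (b) hold, then (E-Mcl) holds. If $n=1$, then conversely (E-Mcl) implies (a) and (b). -/

import Mathlib

open Polynomial Set MeasureTheory

namespace ThirdOrder

noncomputable section

/-- The frequency space `ℝⁿ` with its Euclidean norm. -/
abbrev Freq (n : ℕ) : Type := EuclideanSpace ℝ (Fin n)

/-- Coefficients `a j α t` of the operator
`∂ₜ³ + ∑_{j ≤ 2} ∑_{|α| ≤ 3 - j} a j α (t) ∂ₜ^j ∂ₓ^α`; only the values with `j ≤ 2` are used. -/
abbrev Coeffs (n : ℕ) : Type := ℕ → (Fin n → ℕ) → ℝ → ℂ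

/-- `∑_{j + |α| = m, j ≤ 2} a j α (t) τ^j ξ^α`, as a polynomial in `τ`. -/
def homPart {n : ℕ} (a : Coeffs n) (m : ℕ) (t : ℝ) (ξ : Freq n) : ℂ[X] :=
  ∑ p ∈ (Finset.HasAntidiagonal.antidiagonal m).filter (fun p => p.1 < 3),
    ∑ α ∈ Finset.piAntidiag (Finset.univ : Finset (Fin n)) p.2,
      C (a p.1 α t * ∏ i, (ξ i : ℂ) ^ α i) * X ^ p.1

/-- The principal symbol `L(t,τ,ξ)`, as a polynomial in `τ`. -/
def symL {n : ℕ} (a : Coeffs n) (t : ℝ) (ξ : Freq n) : ℂ[X] :=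
  X ^ 3 + homPart a 3 t ξ

/-- The symbol `M(t,τ,ξ)` of the second order terms, as a polynomial in `τ`. -/
def symM {n : ℕ} (a : Coeffs n) (t : ℝ) (ξ : Freq n) : ℂ[X] :=
  homPart a 2 t ξ

/-- `∂ₜ L(t,τ,ξ)`, as a polynomial in `τ`: the coefficients are differentiated in `t`
(the leading coefficient of `L` is constant). -/
def symDtL {n : ℕ} (a : Coeffs n) (t : ℝ) (ξ : Freq n) : ℂ[X] :=
  homPart (fun j α => deriv (a j α)) 3 t ξ

/-- `M̌ = M - (1/2) ∂ₜ ∂_τ L`, as a polynomial in `τ`. -/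
def symMcheck {n : ℕ} (a : Coeffs n) (t : ℝ) (ξ : Freq n) : ℂ[X] :=
  symM a t ξ - C (1 / 2) * derivative (symDtL a t ξ)

/-- The auxiliary polynomial `𝓛 = L - ∂_τ² L`. -/
def auxL {n : ℕ} (a : Coeffs n) (t : ℝ) (ξ : Freq n) : ℂ[X] :=
  symL a t ξ - derivative (derivative (symL a t ξ))

/-- `r 0, r 1, r 2` are the roots of the monic cubic `P`, repeated according to multiplicity. -/
def IsRootList (P : ℂ[X]) (r : Fin 3 → ℂ) : Prop :=
  P = ∏ j, (X - C (r j))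

/-- `Δ_L^{(1)}`, the sum of the squares of the differences of the roots. -/
def disc1 {n : ℕ} (τ : Fin 3 → ℝ → Freq n → ℝ) (t : ℝ) (ξ : Freq n) : ℝ :=
  (τ 0 t ξ - τ 1 t ξ) ^ 2 + (τ 1 t ξ - τ 2 t ξ) ^ 2 + (τ 2 t ξ - τ 0 t ξ) ^ 2

/-- The logarithmic condition `∫₀ᵀ |f(t,ξ)| dt ≲ log (1 + |ξ|)`, uniformly for `ξ` away from `0`. -/
def LogCondition {n : ℕ} (T : ℝ) (f : ℝ → Freq n → ℝ) : Prop :=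
  ∀ R : ℝ, 0 < R → ∃ K : ℝ, 0 < K ∧ ∀ ξ : Freq n, R ≤ ‖ξ‖ →
    IntervalIntegrable (fun t => f t ξ) volume 0 T ∧
      ∫ t in (0 : ℝ)..T, |f t ξ| ≤ K * Real.log (1 + ‖ξ‖)

/-- The Levi condition on the second order terms: the logarithmic condition for
`∑_{(j,k,l)} |M̌(λ_j)| / (|λ_j - λ_k| |λ_j - λ_l|)`, where `(j,k,l)` runs through the cyclic
permutations (indices in `Fin 3` are added modulo `3`) and `lam` lists the roots of `𝓛`. -/
def LeviM {n : ℕ} (T : ℝ) (a : Coeffs n) (lam : Fin 3 → ℝ → Freq n → ℂ) : Prop :=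
  LogCondition T fun t ξ => ∑ j : Fin 3,
    ‖(symMcheck a t ξ).eval (lam j t ξ)‖ /
      (‖lam j t ξ - lam (j + 1) t ξ‖ * ‖lam j t ξ - lam (j + 2) t ξ‖)

/-- `M̌(t, τ₁(t,ξ), ξ) = 0` for all `t ∈ [0,T]` and all `ξ`. -/
def McheckVanishes {n : ℕ} (T : ℝ) (a : Coeffs n) (τ : Fin 3 → ℝ → Freq n → ℝ) : Prop :=
  ∀ t ∈ Icc 0 T, ∀ ξ : Freq n, (symMcheck a t ξ).eval (τ 0 t ξ : ℂ) = 0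

/-- The quotient `Q = M̌ / (τ - τ₁)` of polynomials in `τ` (exact when `M̌(τ₁) = 0`). -/
def quotQ {n : ℕ} (a : Coeffs n) (τ : Fin 3 → ℝ → Freq n → ℝ) (t : ℝ) (ξ : Freq n) : ℂ[X] :=
  symMcheck a t ξ /ₘ (X - C (τ 0 t ξ : ℂ))

/-- `|Q(τ_j)| ≲ √Δ_L^{(1)} + |∂ₜ √Δ_L^{(1)}|` on `[0,T] × ℝⁿ` for `j = 1, 3`, at every point where
the derivative `d` on the right exists (one-sided at the ends of `[0,T]`). -/
def QBound {n : ℕ} (T : ℝ) (a : Coeffs n) (τ : Fin 3 → ℝ → Freq n → ℝ) : Prop :=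
  ∃ K : ℝ, 0 < K ∧ ∀ j : Fin 3, j = 0 ∨ j = 2 → ∀ t ∈ Icc 0 T, ∀ ξ : Freq n, ∀ d : ℝ,
    HasDerivWithinAt (fun s => √(disc1 τ s ξ)) d (Icc 0 T) t →
      ‖(quotQ a τ t ξ).eval (τ j t ξ : ℂ)‖ ≤ K * (√(disc1 τ t ξ) + |d|)

end

end ThirdOrder

/-!
If `L` has roots `τ₁, τ₁, τ₃`, then the roots of `𝓛` are `τ₁ + σ`, where `σ` runs through the roots
of the cubic `σ³ - δσ² - 6σ + 2δ` in the gap `δ = τ₃ - τ₁`. They are separated uniformly in `δ`, so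
the Levi sum can be estimated in terms of `δ` and the Taylor coefficients `m₀, m₁, m₂` of `M̌` at
`τ₁`. Since `δ²` and `δ³` are polynomials in `ξ` with analytic coefficients, `δ = δ³ / δ²` is a
linear form in `ξ` with analytic coefficients.

If `m₀ = 0` and `|m₁| ≲ |δ| + |∂ₜδ|`, the Levi sum is bounded by a constant plus a multiple of
`|∂ₜ arsinh δ|`. The number of monotonicity intervals of `t ↦ δ(t, ξ)` is bounded uniformly in `ξ`,
and `arsinh δ` grows like `log |ξ|`, so that the variation of `arsinh δ` is at most a multiple of
`log (1 + |ξ|)`. Conversely, the logarithmic bound along a ray in `ξ` allows `δ` to vanish at most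
one order higher than `m₁` at each `t`, and forces `m₀` to vanish identically.
-/

namespace ThirdOrder

open Filter Topology

section LogarithmicVariation

theorem abs_arsinh_le (s : ℝ) : |Real.arsinh s| ≤ Real.log (1 + 2 * |s|) := by
  wlog hs : 0 ≤ s generalizing s
  · simpa only [Real.arsinh_neg, abs_neg] using this (-s) (by linarith)
  rw [abs_of_nonneg hs, abs_of_nonneg (Real.arsinh_nonneg_iff.2 hs), Real.arsinh]
  have hsqrt : √(1 + s ^ 2) ≤ 1 + s := Real.sqrt_le_iff.2 ⟨by linarith, by nlinarith⟩
  exact Real.log_le_log (by positivity) (by linarith)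

/-- `f` has constant sign on `s`, in the weak sense: it may vanish there. -/
def ConstSignOn (f : ℝ → ℝ) (s : Set ℝ) : Prop :=
  (∀ t ∈ s, 0 ≤ f t) ∨ ∀ t ∈ s, f t ≤ 0

variable {f : ℝ → ℝ} {s : Set ℝ} {a b B : ℝ}

theorem ConstSignOn.mono {s' : Set ℝ} (h : ConstSignOn f s) (hs : s' ⊆ s) : ConstSignOn f s' :=
  h.imp (fun h t ht => h t (hs ht)) fun h t ht => h t (hs ht)

theorem constSignOn_of_forall_ne_zero (hs : IsPreconnected s) (hf : ContinuousOn f s)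
    (h0 : ∀ t ∈ s, f t ≠ 0) : ConstSignOn f s := by
  by_contra h
  simp only [ConstSignOn, not_or, not_forall, not_le, exists_prop] at h
  obtain ⟨⟨x, hx, hfx⟩, y, hy, hfy⟩ := h
  obtain ⟨t, ht, hft⟩ := hs.intermediate_value hx hy hf ⟨hfx.le, hfy.le⟩
  exact h0 t ht hft

theorem monotoneOn_or_antitoneOn_of_constSignOn_deriv (hs : Convex ℝ s)
    (hf : ∀ t ∈ s, DifferentiableAt ℝ f t) (h : ConstSignOn (deriv f) s) :
    MonotoneOn f s ∨ AntitoneOn f s := by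
  have hc : ContinuousOn f s := fun t ht => (hf t ht).continuousAt.continuousWithinAt
  have hd : DifferentiableOn ℝ f (interior s) := fun t ht =>
    (hf t (interior_subset ht)).differentiableWithinAt
  exact h.imp
    (fun h => monotoneOn_of_deriv_nonneg hs hc hd fun t ht => h t (interior_subset ht))
    fun h => antitoneOn_of_deriv_nonpos hs hc hd fun t ht => h t (interior_subset ht)

theorem exists_constSignOn_Icc_of_constSignOn_deriv (hab : a ≤ b)
    (hf : ∀ t ∈ Icc a b, DifferentiableAt ℝ f t) (h : ConstSignOn (deriv f) (Icc a b)) :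
    ∃ c ∈ Icc a b, ConstSignOn f (Icc a c) ∧ ConstSignOn f (Icc c b) := by
  by_cases h0 : ∀ t ∈ Icc a b, f t ≠ 0
  · have hsign := constSignOn_of_forall_ne_zero isPreconnected_Icc
      (fun t ht => (hf t ht).continuousAt.continuousWithinAt) h0
    exact ⟨a, left_mem_Icc.2 hab, hsign.mono (Icc_subset_Icc_right hab), hsign⟩
  push Not at h0
  obtain ⟨c, hc, hfc⟩ := h0
  have hleft : ∀ t ∈ Icc a c, t ∈ Icc a b := fun t ht => ⟨ht.1, ht.2.trans hc.2⟩
  have hright : ∀ t ∈ Icc c b, t ∈ Icc a b := fun t ht => ⟨hc.1.trans ht.1, ht.2⟩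
  refine ⟨c, hc, ?_⟩
  rcases monotoneOn_or_antitoneOn_of_constSignOn_deriv (convex_Icc a b) hf h with hm | hm
  · exact ⟨Or.inr fun t ht => hfc ▸ hm (hleft t ht) hc ht.2,
      Or.inl fun t ht => hfc ▸ hm hc (hright t ht) ht.1⟩
  · exact ⟨Or.inl fun t ht => hfc ▸ hm (hleft t ht) hc ht.2,
      Or.inr fun t ht => hfc ▸ hm hc (hright t ht) ht.1⟩

theorem contDiffAt_iteratedDeriv {𝕜 E : Type*} [NontriviallyNormedField 𝕜]
    [NormedAddCommGroup E] [NormedSpace 𝕜 E] {f : 𝕜 → E} {t : 𝕜} {n m : WithTop ℕ∞} {k : ℕ}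
    (hf : ContDiffAt 𝕜 n f t) (h : m + k ≤ n) : ContDiffAt 𝕜 m (iteratedDeriv k f) t := by
  rw [iteratedDeriv_eq_equiv_comp]
  exact (ContinuousMultilinearMap.piFieldEquiv 𝕜 (Fin k) E).symm.contDiff.contDiffAt.comp t
    (hf.iteratedFDeriv_right h)

theorem continuousAt_deriv {𝕜 E : Type*} [NontriviallyNormedField 𝕜]
    [NormedAddCommGroup E] [NormedSpace 𝕜 E] {f : 𝕜 → E} {t : 𝕜} (hf : ContDiffAt 𝕜 1 f t) :
    ContinuousAt (deriv f) t :=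
  iteratedDeriv_one (f := f) ▸
    (contDiffAt_iteratedDeriv hf (m := 0) (k := 1) (by simp)).continuousAt

/-- The total variation over `[a, b]` of `arsinh ∘ f`. -/
noncomputable def arsinhVariation (f : ℝ → ℝ) (a b : ℝ) : ℝ :=
  ∫ t in a..b, |deriv f t| / √(1 + f t ^ 2)

theorem intervalIntegrable_abs_deriv_div_sqrt (hf : ∀ t ∈ uIcc a b, ContDiffAt ℝ 1 f t) :
    IntervalIntegrable (fun t => |deriv f t| / √(1 + f t ^ 2)) volume a b := by
  refine ContinuousOn.intervalIntegrable fun t ht => ContinuousAt.continuousWithinAt ?_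
  have hf0 := (hf t ht).continuousAt
  exact (continuousAt_deriv (hf t ht)).abs.div (by fun_prop) (by positivity)

theorem integral_abs_eq_abs_integral_of_constSignOn (hab : a ≤ b)
    (hs : ConstSignOn f (Icc a b)) : ∫ t in a..b, |f t| = |∫ t in a..b, f t| := by
  rcases hs with hs | hs
  · rw [abs_of_nonneg (intervalIntegral.integral_nonneg hab hs)]
    exact intervalIntegral.integral_congr fun t ht => abs_of_nonneg (hs t (uIcc_of_le hab ▸ ht))
  · rw [← abs_neg, ← intervalIntegral.integral_neg, abs_of_nonneg
      (intervalIntegral.integral_nonneg hab fun t ht => neg_nonneg.2 (hs t ht))]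
    exact intervalIntegral.integral_congr fun t ht => abs_of_nonpos (hs t (uIcc_of_le hab ▸ ht))

theorem arsinhVariation_eq_abs_sub (hab : a ≤ b) (hf : ∀ t ∈ Icc a b, ContDiffAt ℝ 1 f t)
    (hs : ConstSignOn (deriv f) (Icc a b)) :
    arsinhVariation f a b = |Real.arsinh (f b) - Real.arsinh (f a)| := by
  have hderiv : ∀ t ∈ uIcc a b, HasDerivAt (fun t => Real.arsinh (f t))
      (deriv f t / √(1 + f t ^ 2)) t := fun t ht => by
    simpa only [smul_eq_mul, inv_mul_eq_div] using
      ((hf t (uIcc_of_le hab ▸ ht)).differentiableAt one_ne_zero).hasDerivAt.arsinh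
  have hint : IntervalIntegrable (fun t => deriv f t / √(1 + f t ^ 2)) volume a b := by
    refine ContinuousOn.intervalIntegrable fun t ht => ContinuousAt.continuousWithinAt ?_
    have hft := hf t (uIcc_of_le hab ▸ ht)
    have hf0 := hft.continuousAt
    exact (continuousAt_deriv hft).div (by fun_prop) (by positivity)
  have hsign : ConstSignOn (fun t => deriv f t / √(1 + f t ^ 2)) (Icc a b) :=
    hs.imp (fun h t ht => div_nonneg (h t ht) (Real.sqrt_nonneg _))
      fun h t ht => div_nonpos_of_nonpos_of_nonneg (h t ht) (Real.sqrt_nonneg _)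
  rw [← intervalIntegral.integral_eq_sub_of_hasDerivAt hderiv hint,
    ← integral_abs_eq_abs_integral_of_constSignOn hab hsign, arsinhVariation]
  simp only [abs_div, abs_of_nonneg (Real.sqrt_nonneg _)]

theorem arsinhVariation_le_of_constSignOn_deriv (hab : a ≤ b)
    (hf : ∀ t ∈ Icc a b, ContDiffAt ℝ 1 f t) (hB : ∀ t ∈ Icc a b, |f t| ≤ B)
    (hs : ConstSignOn (deriv f) (Icc a b)) :
    arsinhVariation f a b ≤ 2 * Real.log (1 + 2 * B) := by
  have hbound : ∀ t ∈ Icc a b, |Real.arsinh (f t)| ≤ Real.log (1 + 2 * B) := fun t ht =>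
    (abs_arsinh_le _).trans (Real.log_le_log (by positivity) (by linarith [hB t ht]))
  rw [arsinhVariation_eq_abs_sub hab hf hs, two_mul]
  exact (abs_sub _ _).trans (add_le_add (hbound b (right_mem_Icc.2 hab))
    (hbound a (left_mem_Icc.2 hab)))

theorem arsinhVariation_add {c : ℝ} (hc : c ∈ Icc a b)
    (hf : ∀ t ∈ Icc a b, ContDiffAt ℝ 1 f t) :
    arsinhVariation f a c + arsinhVariation f c b = arsinhVariation f a b :=
  intervalIntegral.integral_add_adjacent_intervals
    (intervalIntegrable_abs_deriv_div_sqrt fun t ht =>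
      hf t (Icc_subset_Icc_right hc.2 (uIcc_of_le hc.1 ▸ ht)))
    (intervalIntegrable_abs_deriv_div_sqrt fun t ht =>
      hf t (Icc_subset_Icc_left hc.1 (uIcc_of_le hc.2 ▸ ht)))

theorem arsinhVariation_le_of_constSignOn_iteratedDeriv (m : ℕ) (hab : a ≤ b)
    (hf : ∀ t ∈ Icc a b, ContDiffAt ℝ (m + 1) f t) (hB : ∀ t ∈ Icc a b, |f t| ≤ B)
    (hs : ConstSignOn (iteratedDeriv (m + 1) f) (Icc a b)) :
    arsinhVariation f a b ≤ 2 ^ (m + 1) * Real.log (1 + 2 * B) := by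
  induction m generalizing a b with
  | zero =>
    rw [zero_add, pow_one]
    exact arsinhVariation_le_of_constSignOn_deriv hab (by simpa using hf) hB
      (by simpa only [zero_add, iteratedDeriv_one] using hs)
  | succ m ih =>
    have hdiff : ∀ t ∈ Icc a b, DifferentiableAt ℝ (iteratedDeriv (m + 1) f) t := fun t ht =>
      (contDiffAt_iteratedDeriv (hf t ht) (m := 1)
        (by push_cast; rw [add_comm])).differentiableAt one_ne_zero
    rw [iteratedDeriv_succ] at hs
    obtain ⟨c, hc, hac, hcb⟩ := exists_constSignOn_Icc_of_constSignOn_deriv hab hdiff hs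
    have hle : ((m + 1 : ℕ) : WithTop ℕ∞) ≤ ((m + 1 : ℕ) : WithTop ℕ∞) + 1 := by simp
    have hleft : Icc a c ⊆ Icc a b := Icc_subset_Icc_right hc.2
    have hright : Icc c b ⊆ Icc a b := Icc_subset_Icc_left hc.1
    calc arsinhVariation f a b
        = arsinhVariation f a c + arsinhVariation f c b :=
          (arsinhVariation_add hc fun t ht => (hf t ht).of_le (by simp)).symm
      _ ≤ 2 ^ (m + 1) * Real.log (1 + 2 * B) + 2 ^ (m + 1) * Real.log (1 + 2 * B) :=
          add_le_add
            (ih hc.1 (fun t ht => (hf t (hleft ht)).of_le hle) (fun t ht => hB t (hleft ht)) hac)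
            (ih hc.2 (fun t ht => (hf t (hright ht)).of_le hle) (fun t ht => hB t (hright ht)) hcb)
      _ = 2 ^ (m + 1 + 1) * Real.log (1 + 2 * B) := by ring

end LogarithmicVariation
section AnalyticCurve

theorem eqOn_zero_of_forall_iteratedDeriv_eq_zero {𝕜 F : Type*} [NontriviallyNormedField 𝕜]
    [CharZero 𝕜] [NormedAddCommGroup F] [NormedSpace 𝕜 F] [CompleteSpace F] {f : 𝕜 → F}
    {s : Set 𝕜} {t₀ : 𝕜} (hf : AnalyticOnNhd 𝕜 f s) (hs : IsPreconnected s) (ht₀ : t₀ ∈ s)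
    (h : ∀ m, iteratedDeriv m f t₀ = 0) : EqOn f 0 s := by
  refine hf.eqOn_zero_of_preconnected_of_eventuallyEq_zero hs ht₀
    (analyticOrderAt_eq_top.1 (ENat.eq_top_iff_forall_ge.2 fun k => ?_))
  exact (natCast_le_analyticOrderAt_iff_iteratedDeriv_eq_zero (hf t₀ ht₀)).2 fun i _ => h i

variable {E : Type*} [NormedAddCommGroup E] [InnerProductSpace ℝ E] {γ : ℝ → E} {a b t₀ : ℝ}

theorem iteratedDeriv_inner_const {t : ℝ} {k : ℕ} (c : E) (hγ : ContDiffAt ℝ k γ t) :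
    iteratedDeriv k (fun t => inner ℝ c (γ t)) t = inner ℝ c (iteratedDeriv k γ t) :=
  congrArg (fun L => L fun _ => 1) ((innerSL ℝ c).iteratedFDeriv_comp_left hγ le_rfl)

theorem inner_iteratedDeriv_eq_zero_of_forall [CompleteSpace E] {s : Set ℝ} {c : E}
    (hγ : AnalyticOnNhd ℝ γ s) (hs : IsPreconnected s) (ht₀ : t₀ ∈ s)
    (h : ∀ m, inner ℝ c (iteratedDeriv (m + 1) γ t₀) = 0) (m : ℕ) {t : ℝ} (ht : t ∈ s) :
    inner ℝ c (iteratedDeriv (m + 1) γ t) = 0 := by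
  have hγ' : AnalyticOnNhd ℝ (iteratedDeriv (m + 1) γ) s := by
    rw [iteratedDeriv_eq_iterate]
    exact hγ.iterated_deriv _
  refine eqOn_zero_of_forall_iteratedDeriv_eq_zero (f := fun t => inner ℝ c _)
    ((innerSL ℝ c).comp_analyticOnNhd hγ') hs ht₀ (fun k => ?_) ht
  rw [iteratedDeriv_inner_const c (hγ' t₀ ht₀).contDiffAt]
  simpa only [iteratedDeriv_eq_iterate, ← Function.iterate_add_apply, ← add_assoc] using h (k + m)

/-- The span of all derivatives of positive order of the curve `γ` at `t₀`. For analytic `γ` its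
orthogonal complement consists of the `c` such that `⟪c, γ⟫` is constant. -/
noncomputable def derivSpan (γ : ℝ → E) (t₀ : ℝ) : Submodule ℝ E :=
  Submodule.span ℝ (range fun m : ℕ => iteratedDeriv (m + 1) γ t₀)

theorem exists_inner_iteratedDeriv_ne_zero {c : E} (hc : c ∈ derivSpan γ t₀) (hc0 : c ≠ 0) :
    ∃ m, inner ℝ c (iteratedDeriv (m + 1) γ t₀) ≠ 0 := by
  by_contra! h
  have hperp : c ∈ (derivSpan γ t₀)ᗮ := by
    rw [Submodule.mem_orthogonal']
    intro v hv
    induction hv using Submodule.span_induction with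
    | mem v hv => obtain ⟨m, rfl⟩ := hv; exact h m
    | zero => exact inner_zero_right c
    | add v w _ _ hv hw => rw [inner_add_right, hv, hw, add_zero]
    | smul r v _ hv => rw [inner_smul_right, hv, mul_zero]
  exact hc0 (inner_self_eq_zero.1 (Submodule.inner_right_of_mem_orthogonal hc hperp))

variable [FiniteDimensional ℝ E]

theorem exists_nhds_inner_iteratedDeriv_ne_zero (hγ : AnalyticAt ℝ γ t₀) :
    ∃ M : ℕ, ∃ U ∈ 𝓝 t₀, ∀ c ∈ (derivSpan γ t₀ : Set E) ∩ Metric.sphere 0 1,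
      ∃ m ≤ M, ∀ t ∈ U, inner ℝ c (iteratedDeriv (m + 1) γ t) ≠ 0 := by
  have hcompact : IsCompact ((derivSpan γ t₀ : Set E) ∩ Metric.sphere 0 1) :=
    (isCompact_sphere 0 1).inter_left (derivSpan γ t₀).closed_of_finiteDimensional
  refine hcompact.induction_on ⟨0, univ, univ_mem, by simp⟩ ?_ ?_ fun c hc => ?_
  · rintro S S' hSS' ⟨M, U, hU, h⟩
    exact ⟨M, U, hU, fun c hc => h c (hSS' hc)⟩
  · rintro S S' ⟨M, U, hU, h⟩ ⟨M', U', hU', h'⟩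
    refine ⟨max M M', U ∩ U', inter_mem hU hU', fun c hc => ?_⟩
    rcases hc with hc | hc
    · obtain ⟨m, hm, hne⟩ := h c hc
      exact ⟨m, le_max_of_le_left hm, fun t ht => hne t ht.1⟩
    · obtain ⟨m, hm, hne⟩ := h' c hc
      exact ⟨m, le_max_of_le_right hm, fun t ht => hne t ht.2⟩
  · obtain ⟨m, hm⟩ := exists_inner_iteratedDeriv_ne_zero hc.1
      (norm_ne_zero_iff.1 (by rw [mem_sphere_zero_iff_norm.1 hc.2]; exact one_ne_zero))
    have hcont : ContinuousAt (iteratedDeriv (m + 1) γ) t₀ :=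
      (contDiffAt_iteratedDeriv hγ.contDiffAt (m := 0) (zero_add _).le).continuousAt
    have hev : ∀ᶠ x : E × ℝ in 𝓝 (c, t₀), inner ℝ x.1 (iteratedDeriv (m + 1) γ x.2) ≠ 0 :=
      (continuousAt_fst.inner (hcont.comp' continuousAt_snd)).eventually_ne hm
    obtain ⟨V, hV, U, hU, hVU⟩ := mem_nhds_prod_iff.1 hev
    exact ⟨V, mem_nhdsWithin_of_mem_nhds hV, m, U, hU,
      fun c' hc' => ⟨m, le_rfl, fun t ht => hVU (mk_mem_prod hc' ht)⟩⟩

theorem exists_nhds_constSignOn_iteratedDeriv_inner {s : Set ℝ} (hγ : AnalyticOnNhd ℝ γ s)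
    (hs : IsPreconnected s) (ht₀ : t₀ ∈ s) :
    ∃ M : ℕ, ∃ U ∈ 𝓝 t₀, ∀ (c : E) (x y : ℝ), Icc x y ⊆ s → Icc x y ⊆ U → ∃ m ≤ M,
      ConstSignOn (iteratedDeriv (m + 1) fun t => inner ℝ c (γ t)) (Icc x y) := by
  obtain ⟨M, U, hU, hne⟩ := exists_nhds_inner_iteratedDeriv_ne_zero (hγ t₀ ht₀)
  refine ⟨M, U, hU, fun c x y hxys hxyU => ?_⟩
  obtain ⟨v, hv, w, hw, rfl⟩ := (derivSpan γ t₀).exists_add_mem_mem_orthogonal c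
  have hwγ : ∀ k, inner ℝ w (iteratedDeriv (k + 1) γ t₀) = 0 := fun k =>
    (Submodule.mem_orthogonal' _ w).1 hw _ (Submodule.subset_span ⟨k, rfl⟩)
  have hcongr : ∀ m, ∀ t ∈ Icc x y, iteratedDeriv (m + 1) (fun t => inner ℝ (v + w) (γ t)) t =
      inner ℝ v (iteratedDeriv (m + 1) γ t) := fun m t ht => by
    rw [iteratedDeriv_inner_const _ (hγ t (hxys ht)).contDiffAt, inner_add_left,
      inner_iteratedDeriv_eq_zero_of_forall hγ hs ht₀ hwγ m (hxys ht), add_zero]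
  rcases eq_or_ne v 0 with rfl | hv0
  · exact ⟨0, M.zero_le, Or.inl fun t ht => by rw [hcongr 0 t ht, inner_zero_left]⟩
  obtain ⟨m, hmM, hm⟩ := hne (‖v‖⁻¹ • v) ⟨Submodule.smul_mem _ _ hv, by
    rw [mem_sphere_zero_iff_norm, norm_smul, norm_inv, norm_norm,
      inv_mul_cancel₀ (norm_ne_zero_iff.2 hv0)]⟩
  refine ⟨m, hmM, constSignOn_of_forall_ne_zero isPreconnected_Icc ?_ fun t ht h0 => ?_⟩
  · refine ContinuousOn.congr (f := fun t => inner ℝ v (iteratedDeriv (m + 1) γ t))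
      (fun t ht => ContinuousAt.continuousWithinAt ?_) (hcongr m)
    exact continuousAt_const.inner (contDiffAt_iteratedDeriv (hγ t (hxys ht)).contDiffAt
      (m := 0) (zero_add _).le).continuousAt
  · rw [hcongr m t ht] at h0
    exact hm t (hxyU ht) (by rw [real_inner_smul_left, h0, mul_zero])

theorem exists_arsinhVariation_inner_le (hab : a ≤ b) (hγ : AnalyticOnNhd ℝ γ (Icc a b)) :
    ∃ N : ℝ, 0 ≤ N ∧ ∀ (c : E) (B : ℝ), (∀ t ∈ Icc a b, |inner ℝ c (γ t)| ≤ B) →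
      arsinhVariation (fun t => inner ℝ c (γ t)) a b ≤ N * Real.log (1 + 2 * B) := by
  choose! M U hU hsign using fun t₀ (ht₀ : t₀ ∈ Icc a b) =>
    exists_nhds_constSignOn_iteratedDeriv_inner hγ isPreconnected_Icc ht₀
  obtain ⟨u, hu0, humono, ⟨N, hN⟩, hcover⟩ := exists_monotone_Icc_subset_open_cover_Icc hab
    (c := fun t₀ : Icc a b => Subtype.val ⁻¹' interior (U t₀))
    (fun t₀ => isOpen_interior.preimage continuous_subtype_val)
    (fun t₀ _ => mem_iUnion.2 ⟨t₀, mem_interior_iff_mem_nhds.2 (hU t₀ t₀.2)⟩)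
  choose p hp using hcover
  have hle : ∀ k, (u k : ℝ) ≤ u (k + 1) := fun k => humono k.le_succ
  have hsub : ∀ k, Icc (u k : ℝ) (u (k + 1)) ⊆ Icc a b := fun k =>
    Icc_subset_Icc (u k).2.1 (u (k + 1)).2.2
  have hpU : ∀ k, Icc (u k : ℝ) (u (k + 1)) ⊆ U (p k) := fun k t ht =>
    interior_subset (hp k (a := ⟨t, hsub k ht⟩) ht)
  refine ⟨∑ k ∈ Finset.range N, 2 ^ (M (p k) + 1), by positivity, fun c B hB => ?_⟩
  have hlog : 0 ≤ Real.log (1 + 2 * B) := Real.log_nonneg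
    (by linarith [(abs_nonneg _).trans (hB a (left_mem_Icc.2 hab))])
  have hf : ∀ (j : ℕ), ∀ t ∈ Icc a b, ContDiffAt ℝ j (fun t => inner ℝ c (γ t)) t :=
    fun j t ht => contDiffAt_const.inner ℝ (hγ t ht).contDiffAt
  have hsum := intervalIntegral.sum_integral_adjacent_intervals (n := N) fun k _ =>
    intervalIntegrable_abs_deriv_div_sqrt fun t ht =>
      mod_cast hf 1 t (hsub k (uIcc_of_le (hle k) ▸ ht))
  rw [hu0, hN N le_rfl] at hsum
  rw [arsinhVariation, ← hsum, Finset.sum_mul]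
  refine Finset.sum_le_sum fun k _ => ?_
  obtain ⟨m, hmM, hm⟩ := hsign (p k) (p k).2 c (u k) (u (k + 1)) (hsub k) (hpU k)
  refine (arsinhVariation_le_of_constSignOn_iteratedDeriv m (hle k)
    (fun t ht => mod_cast hf (m + 1) t (hsub k ht)) (fun t ht => hB t (hsub k ht)) hm).trans ?_
  gcongr
  exact one_le_two

end AnalyticCurve
section AuxiliaryCubic

variable {δ x : ℝ}

theorem cubic_abs_mul_abs_sq_sub_two (hx : x ^ 3 - δ * x ^ 2 - 6 * x + 2 * δ = 0) :
    |δ| * |x ^ 2 - 2| = |x| * |x ^ 2 - 6| := by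
  rw [← abs_mul, ← abs_mul, show δ * (x ^ 2 - 2) = x * (x ^ 2 - 6) by linear_combination -hx]

theorem abs_cubic_root_le (hx : x ^ 3 - δ * x ^ 2 - 6 * x + 2 * δ = 0) : |x| ≤ 3 + |δ| := by
  by_contra! hlt
  have hδ := abs_nonneg δ
  have heq := cubic_abs_mul_abs_sq_sub_two hx
  rw [← sq_abs x, abs_of_pos (by nlinarith : 0 < |x| ^ 2 - 2),
    abs_of_pos (by nlinarith : 0 < |x| ^ 2 - 6)] at heq
  nlinarith

theorem abs_cubic_cofactor_le (hx : x ^ 3 - δ * x ^ 2 - 6 * x + 2 * δ = 0) :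
    |x ^ 2 - δ * x - 6| ≤ 7 * (1 + |δ|) := by
  have hδ := abs_nonneg δ
  have hprod : |x| * |x ^ 2 - δ * x - 6| = 2 * |δ| := by
    rw [← abs_mul, show x * (x ^ 2 - δ * x - 6) = -(2 * δ) by linear_combination hx, abs_neg,
      abs_mul, abs_two]
  rcases le_total 1 |x| with h1 | h1
  · nlinarith [abs_nonneg (x ^ 2 - δ * x - 6)]
  · have htri : |x ^ 2 - δ * x - 6| ≤ |x| ^ 2 + |δ| * |x| + 6 :=
      calc |x ^ 2 - δ * x - 6| ≤ |x ^ 2 - δ * x| + |6| := abs_sub _ _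
        _ ≤ |x ^ 2| + |δ * x| + |6| := by gcongr; exact abs_sub _ _
        _ = |x| ^ 2 + |δ| * |x| + 6 := by rw [abs_pow, abs_mul, Nat.abs_ofNat]
    nlinarith [abs_nonneg x]

/-- The derivative at `x` of the cubic `σ³ - δσ² - 6σ + 2δ`. -/
def cubicDeriv (δ x : ℝ) : ℝ := 3 * x ^ 2 - 2 * δ * x - 6

theorem cubicDeriv_mul (hx : x ^ 3 - δ * x ^ 2 - 6 * x + 2 * δ = 0) :
    cubicDeriv δ x * (x ^ 2 - 2) = x ^ 4 + 12 := by
  rw [cubicDeriv]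
  linear_combination 2 * x * hx

theorem abs_cubicDeriv_mul (hx : x ^ 3 - δ * x ^ 2 - 6 * x + 2 * δ = 0) :
    |cubicDeriv δ x| * |x ^ 2 - 2| = x ^ 4 + 12 := by
  rw [← abs_mul, cubicDeriv_mul hx, abs_of_pos (by positivity)]

theorem cubicDeriv_ne_zero (hx : x ^ 3 - δ * x ^ 2 - 6 * x + 2 * δ = 0) : cubicDeriv δ x ≠ 0 :=
  left_ne_zero_of_mul (b := x ^ 2 - 2) (by rw [cubicDeriv_mul hx]; positivity)

theorem cubic_abs_sq_sub_two_pos (hx : x ^ 3 - δ * x ^ 2 - 6 * x + 2 * δ = 0) :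
    0 < |x ^ 2 - 2| :=
  abs_pos.2 (right_ne_zero_of_mul (a := cubicDeriv δ x) (by rw [cubicDeriv_mul hx]; positivity))

theorem abs_sq_sub_le {y c : ℝ} (hc : 0 ≤ c) : |y ^ 2 - c| ≤ y ^ 2 + c :=
  abs_le.2 ⟨by linarith [sq_nonneg y], by linarith⟩

theorem cubic_root_sq_le (hx : x ^ 3 - δ * x ^ 2 - 6 * x + 2 * δ = 0) :
    x ^ 2 ≤ 2 * |cubicDeriv δ x| := by
  refine le_of_mul_le_mul_right ?_ (cubic_abs_sq_sub_two_pos hx)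
  calc x ^ 2 * |x ^ 2 - 2| ≤ x ^ 2 * (x ^ 2 + 2) := by gcongr; exact abs_sq_sub_le zero_le_two
    _ ≤ 2 * (x ^ 4 + 12) := by nlinarith [sq_nonneg (x ^ 2 - 1)]
    _ = 2 * |cubicDeriv δ x| * |x ^ 2 - 2| := by rw [mul_assoc, abs_cubicDeriv_mul hx]

theorem abs_cubic_root_mul_le (hx : x ^ 3 - δ * x ^ 2 - 6 * x + 2 * δ = 0) :
    |x| * (1 + |δ|) ≤ 8 * |cubicDeriv δ x| := by
  refine le_of_mul_le_mul_right ?_ (cubic_abs_sq_sub_two_pos hx)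
  calc |x| * (1 + |δ|) * |x ^ 2 - 2|
      = |x| * |x ^ 2 - 2| + |x| * (|δ| * |x ^ 2 - 2|) := by ring
    _ = |x| * |x ^ 2 - 2| + |x| ^ 2 * |x ^ 2 - 6| := by
        rw [cubic_abs_mul_abs_sq_sub_two hx]; ring
    _ ≤ |x| * (x ^ 2 + 2) + |x| ^ 2 * (x ^ 2 + 6) := by
        gcongr <;> exact abs_sq_sub_le (by norm_num)
    _ ≤ 8 * (x ^ 4 + 12) := by
        rw [← sq_abs x, ← Even.pow_abs (by decide : Even 4) x]
        nlinarith [sq_nonneg (|x| ^ 2 - 2), sq_nonneg (|x| - 1), sq_nonneg (|x| ^ 2),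
          mul_nonneg (sq_nonneg (|x| - 1)) (sq_nonneg |x|)]
    _ = 8 * |cubicDeriv δ x| * |x ^ 2 - 2| := by rw [mul_assoc, abs_cubicDeriv_mul hx]

/-- The angle in Viète's trigonometric solution of `σ³ - δσ² - 6σ + 2δ = 0`. -/
noncomputable def cubicAngle (δ : ℝ) : ℝ :=
  Real.arccos ((δ / 3) ^ 3 / √(δ ^ 2 / 9 + 2) ^ 3) / 3

/-- The three real roots of `σ³ - δσ² - 6σ + 2δ`, by Viète's trigonometric formula, which makes
their continuity in `δ` evident. -/
noncomputable def cubicRoot (δ : ℝ) (j : Fin 3) : ℝ :=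
  δ / 3 + 2 * √(δ ^ 2 / 9 + 2) * Real.cos (cubicAngle δ + j * (2 * (Real.pi / 3)))

theorem continuous_cubicRoot (j : Fin 3) : Continuous fun δ => cubicRoot δ j := by
  have hangle : Continuous cubicAngle :=
    (Real.continuous_arccos.comp
      (Continuous.div (by fun_prop) (by fun_prop) fun δ => by positivity)).div_const _
  unfold cubicRoot
  fun_prop

theorem cos_three_mul_cubicAngle (δ : ℝ) :
    √(δ ^ 2 / 9 + 2) ^ 3 * Real.cos (3 * cubicAngle δ) = (δ / 3) ^ 3 := by
  have hr : 0 < √(δ ^ 2 / 9 + 2) := by positivity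
  have hle : |(δ / 3) ^ 3 / √(δ ^ 2 / 9 + 2) ^ 3| ≤ 1 := by
    rw [abs_div, abs_pow, abs_pow, abs_of_pos hr, div_le_one (by positivity)]
    exact pow_le_pow_left₀ (abs_nonneg _) (Real.abs_le_sqrt (by nlinarith)) 3
  rw [cubicAngle, mul_div_cancel₀ _ three_ne_zero,
    Real.cos_arccos (abs_le.1 hle).1 (abs_le.1 hle).2]
  field_simp

theorem cubicRoot_vieta (δ : ℝ) :
    cubicRoot δ 0 + cubicRoot δ 1 + cubicRoot δ 2 = δ ∧
    cubicRoot δ 0 * cubicRoot δ 1 + cubicRoot δ 1 * cubicRoot δ 2 +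
      cubicRoot δ 2 * cubicRoot δ 0 = -6 ∧
    cubicRoot δ 0 * cubicRoot δ 1 * cubicRoot δ 2 = -2 * δ := by
  have hcos := cos_three_mul_cubicAngle δ
  rw [Real.cos_three_mul] at hcos
  have h2 : Real.cos (2 * (Real.pi / 3)) = -1 / 2 := by
    rw [Real.cos_two_mul, Real.cos_pi_div_three]; norm_num
  have s2 : Real.sin (2 * (Real.pi / 3)) = √3 / 2 := by
    rw [Real.sin_two_mul, Real.cos_pi_div_three, Real.sin_pi_div_three]; ring
  simp only [cubicRoot, Fin.val_zero, Fin.val_one, Fin.val_two, Nat.cast_zero, Nat.cast_one,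
    Nat.cast_ofNat, zero_mul, one_mul, add_zero, Real.cos_add, Real.cos_two_mul (2 * _),
    Real.sin_two_mul (2 * _), h2, s2]
  set θ := cubicAngle δ
  set r := √(δ ^ 2 / 9 + 2)
  have hr2 : r ^ 2 = δ ^ 2 / 9 + 2 := Real.sq_sqrt (by positivity)
  have h3 : √3 ^ 2 = (3 : ℝ) := Real.sq_sqrt zero_le_three
  have hcs : Real.sin θ ^ 2 + Real.cos θ ^ 2 = 1 := Real.sin_sq_add_cos_sq θ
  refine ⟨by ring, ?_, ?_⟩
  · linear_combination (-3 * r ^ 2) * hcs - r ^ 2 * Real.sin θ ^ 2 * h3 - 3 * hr2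
  · linear_combination 2 * hcos + (-δ * r ^ 2 - 6 * r ^ 3 * Real.cos θ) * hcs +
      (-r ^ 2 * Real.sin θ ^ 2 * δ / 3 - 2 * r ^ 3 * Real.cos θ * Real.sin θ ^ 2) * h3 - δ * hr2

theorem cubicRoot_eq_zero (δ : ℝ) (j : Fin 3) :
    cubicRoot δ j ^ 3 - δ * cubicRoot δ j ^ 2 - 6 * cubicRoot δ j + 2 * δ = 0 := by
  obtain ⟨h1, h2, h3⟩ := cubicRoot_vieta δ
  have hfactor : ∀ x : ℝ, x ^ 3 - δ * x ^ 2 - 6 * x + 2 * δ =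
      ∏ i, (x - cubicRoot δ i) := fun x => by
    rw [Fin.prod_univ_three]
    linear_combination x ^ 2 * h1 - x * h2 + h3
  rw [hfactor, Finset.prod_eq_zero (Finset.mem_univ j) (sub_self _)]

theorem cubicDeriv_cubicRoot (δ : ℝ) (j : Fin 3) :
    cubicDeriv δ (cubicRoot δ j) =
      (cubicRoot δ j - cubicRoot δ (j + 1)) * (cubicRoot δ j - cubicRoot δ (j + 2)) := by
  obtain ⟨h1, h2, -⟩ := cubicRoot_vieta δ
  match j with
  | 0 => simp only [cubicDeriv, Fin.reduceAdd]; linear_combination 2 * cubicRoot δ 0 * h1 - h2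
  | 1 => simp only [cubicDeriv, Fin.reduceAdd]; linear_combination 2 * cubicRoot δ 1 * h1 - h2
  | 2 => simp only [cubicDeriv, Fin.reduceAdd]; linear_combination 2 * cubicRoot δ 2 * h1 - h2

end AuxiliaryCubic

section LeviSum

theorem IsRootList.sum_eq {M : Type*} [AddCommMonoid M] {P : ℂ[X]} {z w : Fin 3 → ℂ}
    (hz : IsRootList P z) (hw : IsRootList P w) (g : ℂ → M) : ∑ j, g (z j) = ∑ j, g (w j) := by
  have hroots : ∀ u : Fin 3 → ℂ, (∏ j, (X - C (u j))).roots = Finset.univ.val.map u := by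
    intro u
    rw [← roots_multiset_prod_X_sub_C (Finset.univ.val.map u), Multiset.map_map]
    rfl
  have hmap : Finset.univ.val.map z = Finset.univ.val.map w := by
    rw [← hroots, ← hroots, ← hz, hw]
  simpa [Finset.sum] using congrArg (fun s => (Multiset.map g s).sum) hmap

theorem IsRootList.eval_derivative {P : ℂ[X]} {z : Fin 3 → ℂ} (hz : IsRootList P z) (j : Fin 3) :
    (derivative P).eval (z j) = (z j - z (j + 1)) * (z j - z (j + 2)) := by
  rw [IsRootList, Fin.prod_univ_three] at hz
  simp only [hz, derivative_mul, derivative_sub, derivative_X, derivative_C, sub_zero, one_mul,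
    mul_one, eval_add, eval_mul, eval_sub, eval_X, eval_C]
  match j with
  | 0 | 1 | 2 => simp only [Fin.reduceAdd]; ring

theorem IsRootList.sum_norm_eval_div_eq {P : ℂ[X]} {z w : Fin 3 → ℂ} (hz : IsRootList P z)
    (hw : IsRootList P w) (Q : ℂ[X]) :
    ∑ j, ‖Q.eval (z j)‖ / (‖z j - z (j + 1)‖ * ‖z j - z (j + 2)‖) =
      ∑ j, ‖Q.eval (w j)‖ / (‖w j - w (j + 1)‖ * ‖w j - w (j + 2)‖) := by
  simp only [← norm_mul, ← hz.eval_derivative, ← hw.eval_derivative]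
  exact hz.sum_eq hw fun x => ‖Q.eval x‖ / ‖(derivative P).eval x‖

/-- The sum `∑ |M̌(λ_j)| / (|λ_j - λ_k| |λ_j - λ_l|)` for a symbol with roots `r`, `r`, `r + δ`:
there `λ_j = r + cubicRoot δ j`, and `m₀`, `m₁`, `m₂` are the coefficients of `M̌` in powers of
`τ - r`. -/
noncomputable def leviSum (δ : ℝ) (m₀ m₁ m₂ : ℂ) : ℝ :=
  ∑ j, ‖m₀ + m₁ * cubicRoot δ j + m₂ * (cubicRoot δ j : ℂ) ^ 2‖ / |cubicDeriv δ (cubicRoot δ j)|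

theorem isRootList_sub_derivative_derivative (r δ : ℝ) {L : ℂ[X]}
    (hL : L = (X - C (r : ℂ)) ^ 2 * (X - C ((r + δ : ℝ) : ℂ))) :
    IsRootList (L - derivative (derivative L)) fun j => (r + cubicRoot δ j : ℂ) := by
  have h2 : derivative (derivative L) = 6 * (X - C (r : ℂ)) - C (2 * δ : ℂ) := by
    simp only [hL, derivative_mul, derivative_pow, derivative_sub, derivative_add, derivative_X,
      derivative_C, Nat.cast_ofNat, Nat.add_one_sub_one, pow_one, sub_zero,
      mul_one, Complex.ofReal_add, C_add, C_mul, derivative_ofNat, zero_mul, zero_add,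
      map_ofNat]
    ring
  obtain ⟨v1, v2, v3⟩ := cubicRoot_vieta δ
  have hC : ∀ {x y : ℝ}, x = y → (C (x : ℂ) : ℂ[X]) = C (y : ℂ) := fun h => by rw [h]
  replace v1 := hC v1
  replace v2 := hC v2
  replace v3 := hC v3
  push_cast [map_add, map_mul, map_neg, map_ofNat] at v1 v2 v3
  rw [IsRootList, Fin.prod_univ_three, h2, hL]
  push_cast [map_add, map_mul, map_ofNat]
  linear_combination (X - C (r : ℂ)) ^ 2 * v1 - (X - C (r : ℂ)) * v2 + v3

theorem eval_add_eq_taylor_of_natDegree_le_two {R : Type*} [CommSemiring R] {Q : R[X]}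
    (hQ : Q.natDegree ≤ 2) (r x : R) : Q.eval (r + x) =
      (taylor r Q).coeff 0 + (taylor r Q).coeff 1 * x + (taylor r Q).coeff 2 * x ^ 2 := by
  rw [add_comm, ← taylor_eval,
    eval_eq_sum_range' (by rw [natDegree_taylor]; lia : (taylor r Q).natDegree < 3)]
  simp only [Finset.sum_range_succ, Finset.sum_range_zero, zero_add, pow_zero, mul_one, pow_one]

theorem sum_norm_eval_div_eq_leviSum {L Q : ℂ[X]} {r δ : ℝ} {z : Fin 3 → ℂ}
    (hL : L = (X - C (r : ℂ)) ^ 2 * (X - C ((r + δ : ℝ) : ℂ))) (hQ : Q.natDegree ≤ 2)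
    (hz : IsRootList (L - derivative (derivative L)) z) :
    ∑ j, ‖Q.eval (z j)‖ / (‖z j - z (j + 1)‖ * ‖z j - z (j + 2)‖) =
      leviSum δ ((taylor (r : ℂ) Q).coeff 0) ((taylor (r : ℂ) Q).coeff 1)
        ((taylor (r : ℂ) Q).coeff 2) := by
  rw [hz.sum_norm_eval_div_eq (isRootList_sub_derivative_derivative r δ hL), leviSum]
  refine Finset.sum_congr rfl fun j _ => ?_
  rw [eval_add_eq_taylor_of_natDegree_le_two hQ, cubicDeriv_cubicRoot, ← Real.norm_eq_abs,
    ← Complex.norm_real, ← norm_mul]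
  push_cast
  simp only [add_sub_add_left_eq_sub]

theorem leviSum_nonneg (δ : ℝ) (m₀ m₁ m₂ : ℂ) : 0 ≤ leviSum δ m₀ m₁ m₂ :=
  Finset.sum_nonneg fun _ _ => by positivity

theorem continuousOn_leviSum {α : Type*} [TopologicalSpace α] {s : Set α} {δ : α → ℝ}
    {m₀ m₁ m₂ : α → ℂ} (hδ : ContinuousOn δ s) (h₀ : ContinuousOn m₀ s)
    (h₁ : ContinuousOn m₁ s) (h₂ : ContinuousOn m₂ s) :
    ContinuousOn (fun t => leviSum (δ t) (m₀ t) (m₁ t) (m₂ t)) s := by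
  unfold leviSum
  refine continuousOn_finsetSum _ fun j _ => ?_
  have hroot : ContinuousOn (fun t => cubicRoot (δ t) j) s :=
    (continuous_cubicRoot j).comp_continuousOn hδ
  refine ContinuousOn.div (by fun_prop) (by unfold cubicDeriv; fun_prop) fun t _ =>
    abs_ne_zero.2 (cubicDeriv_ne_zero (cubicRoot_eq_zero _ _))

theorem leviSum_zero_le (δ : ℝ) (m₁ m₂ : ℂ) :
    leviSum δ 0 m₁ m₂ ≤ 24 * (‖m₂‖ + ‖m₁‖ / (1 + |δ|)) := by
  have hterm : ∀ j, ‖0 + m₁ * cubicRoot δ j + m₂ * (cubicRoot δ j : ℂ) ^ 2‖ /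
      |cubicDeriv δ (cubicRoot δ j)| ≤ 8 * (‖m₂‖ + ‖m₁‖ / (1 + |δ|)) := fun j => by
    have hx := cubicRoot_eq_zero δ j
    have hD := abs_pos.2 (cubicDeriv_ne_zero hx)
    set x := cubicRoot δ j
    have hlin : |x| ≤ 8 * |cubicDeriv δ x| / (1 + |δ|) :=
      (le_div_iff₀ (by positivity)).2 (abs_cubic_root_mul_le hx)
    rw [div_le_iff₀ hD]
    calc ‖0 + m₁ * x + m₂ * (x : ℂ) ^ 2‖ ≤ ‖m₁ * x‖ + ‖m₂ * (x : ℂ) ^ 2‖ := by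
          rw [zero_add]; exact norm_add_le _ _
      _ = ‖m₁‖ * |x| + ‖m₂‖ * x ^ 2 := by
          rw [norm_mul, norm_mul, norm_pow, Complex.norm_real, Real.norm_eq_abs, sq_abs]
      _ ≤ ‖m₁‖ * (8 * |cubicDeriv δ x| / (1 + |δ|)) + ‖m₂‖ * (8 * |cubicDeriv δ x|) := by
          gcongr
          linarith [cubic_root_sq_le hx]
      _ = 8 * (‖m₂‖ + ‖m₁‖ / (1 + |δ|)) * |cubicDeriv δ x| := by ring
  calc leviSum δ 0 m₁ m₂ ≤ ∑ _j : Fin 3, 8 * (‖m₂‖ + ‖m₁‖ / (1 + |δ|)) :=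
        Finset.sum_le_sum fun j _ => hterm j
    _ = 24 * (‖m₂‖ + ‖m₁‖ / (1 + |δ|)) := by
        rw [Fin.sum_const, nsmul_eq_mul]; push_cast; ring

theorem norm_sum_mul_div_le_leviSum {δ K : ℝ} {m₀ m₁ m₂ : ℂ} {φ : Fin 3 → ℝ}
    (hφ : ∀ j, |φ j| ≤ K) :
    ‖∑ j, (m₀ + m₁ * cubicRoot δ j + m₂ * (cubicRoot δ j : ℂ) ^ 2) * φ j /
      (cubicDeriv δ (cubicRoot δ j) : ℂ)‖ ≤ K * leviSum δ m₀ m₁ m₂ := by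
  rw [leviSum, Finset.mul_sum]
  refine norm_sum_le_of_le _ fun j _ => ?_
  rw [norm_div, norm_mul, Complex.norm_real, Complex.norm_real, Real.norm_eq_abs,
    Real.norm_eq_abs, mul_comm _ |φ j|, mul_div_assoc]
  exact mul_le_mul_of_nonneg_right (hφ j) (by positivity)

theorem cubicRoot_lagrange (δ : ℝ) (m₀ m₁ m₂ : ℂ) :
    ∑ j, (m₀ + m₁ * cubicRoot δ j + m₂ * (cubicRoot δ j : ℂ) ^ 2) *
      ((cubicRoot δ j ^ 2 - δ * cubicRoot δ j - 6 : ℝ) : ℂ) /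
        (cubicDeriv δ (cubicRoot δ j) : ℂ) = m₀ ∧
    ∑ j, (m₀ + m₁ * cubicRoot δ j + m₂ * (cubicRoot δ j : ℂ) ^ 2) *
      ((cubicRoot δ j - δ : ℝ) : ℂ) / (cubicDeriv δ (cubicRoot δ j) : ℂ) = m₁ := by
  obtain ⟨h1, h2, -⟩ := cubicRoot_vieta δ
  have hne := fun j => cubicDeriv_ne_zero (cubicRoot_eq_zero δ j)
  have hd0 := cubicDeriv_cubicRoot δ 0
  have hd1 := cubicDeriv_cubicRoot δ 1
  have hd2 := cubicDeriv_cubicRoot δ 2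
  have n0 := hne 0
  have n1 := hne 1
  simp only [Fin.sum_univ_three, Fin.isValue, Fin.reduceAdd] at hd0 hd1 hd2 ⊢
  set x := cubicRoot δ 0
  set y := cubicRoot δ 1
  set z := cubicRoot δ 2
  rw [hd0] at n0
  rw [hd1] at n1
  have hxy : (x : ℂ) - y ≠ 0 := by exact_mod_cast left_ne_zero_of_mul n0
  have hxz : (x : ℂ) - z ≠ 0 := by exact_mod_cast right_ne_zero_of_mul n0
  have hyz : (y : ℂ) - z ≠ 0 := by exact_mod_cast left_ne_zero_of_mul n1
  rw [hd0, hd1, hd2,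
    show x ^ 2 - δ * x - 6 = y * z by linear_combination x * h1 - h2,
    show y ^ 2 - δ * y - 6 = z * x by linear_combination y * h1 - h2,
    show z ^ 2 - δ * z - 6 = x * y by linear_combination z * h1 - h2,
    show x - δ = -(y + z) by linear_combination h1,
    show y - δ = -(z + x) by linear_combination h1,
    show z - δ = -(x + y) by linear_combination h1]
  push_cast
  rw [← neg_sub (x : ℂ) y, ← neg_sub (x : ℂ) z, ← neg_sub (y : ℂ) z]
  constructor <;> (field_simp; ring)

theorem norm_le_mul_leviSum (δ : ℝ) (m₀ m₁ m₂ : ℂ) :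
    ‖m₀‖ ≤ 7 * (1 + |δ|) * leviSum δ m₀ m₁ m₂ ∧ ‖m₁‖ ≤ 7 * (1 + |δ|) * leviSum δ m₀ m₁ m₂ := by
  obtain ⟨h0, h1⟩ := cubicRoot_lagrange δ m₀ m₁ m₂
  refine ⟨?_, ?_⟩
  · conv_lhs => rw [← h0]
    exact norm_sum_mul_div_le_leviSum fun j => abs_cubic_cofactor_le (cubicRoot_eq_zero δ j)
  · conv_lhs => rw [← h1]
    refine norm_sum_mul_div_le_leviSum fun j => ?_
    linarith [abs_sub (cubicRoot δ j) δ, abs_cubic_root_le (cubicRoot_eq_zero δ j), abs_nonneg δ]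

end LeviSum

section RationalParametrization

theorem exists_polynomial_of_sq_of_cube {ι K : Type*} [Field K] {x g : ι → K} {q c : K[X]}
    (hx : (range x).Infinite) (hq : ∀ i, g i ^ 2 = q.eval (x i))
    (hc : ∀ i, g i ^ 3 = c.eval (x i)) :
    ∃ h : K[X], h ^ 2 = q ∧ ∀ i, g i = h.eval (x i) := by
  have hcq : c ^ 2 = q ^ 3 := by
    refine eq_of_infinite_eval_eq _ _ (hx.mono ?_)
    rintro _ ⟨i, rfl⟩
    simp only [mem_ofPred_eq, eval_pow, ← hq, ← hc]
    ring
  rcases eq_or_ne q 0 with rfl | hq0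
  · exact ⟨0, zero_pow two_ne_zero, fun i => by simpa using hq i⟩
  obtain ⟨h, rfl⟩ : q ∣ c := by
    refine (UniqueFactorizationMonoid.pow_dvd_pow_iff_dvd two_ne_zero).1 ⟨q, ?_⟩
    rw [hcq]; ring
  have hsq : h ^ 2 = q := mul_left_cancel₀ (pow_ne_zero 2 hq0) (by rw [← mul_pow, hcq]; ring)
  refine ⟨h, hsq, fun i => ?_⟩
  rcases eq_or_ne (g i) 0 with hg | hg
  · have : h.eval (x i) ^ 2 = 0 := by rw [← eval_pow, hsq, ← hq, hg, zero_pow two_ne_zero]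
    rw [hg, eq_zero_of_pow_eq_zero this]
  · refine mul_left_cancel₀ (pow_ne_zero 2 hg) ?_
    rw [← pow_succ, hc, eval_mul, ← hq]

theorem exists_affine_of_sq_of_cube {ι K : Type*} [Field K] {x g : ι → K} {q c : K[X]}
    (hx : (range x).Infinite) (hdeg : q.natDegree ≤ 2) (hq : ∀ i, g i ^ 2 = q.eval (x i))
    (hc : ∀ i, g i ^ 3 = c.eval (x i)) : ∃ b d : K, ∀ i, g i = b * x i + d := by
  obtain ⟨h, rfl, hg⟩ := exists_polynomial_of_sq_of_cube hx hq hc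
  have hh : h.natDegree ≤ 1 := by
    rw [natDegree_pow] at hdeg
    lia
  obtain ⟨b, d, rfl⟩ := exists_eq_X_add_C_of_natDegree_le_one hh
  exact ⟨b, d, fun i => by simpa using hg i⟩

theorem analyticAt_div_of_sq_eq_cube {𝕜 : Type*} [NontriviallyNormedField 𝕜] {c q : 𝕜 → 𝕜} {x : 𝕜}
    (hc : AnalyticAt 𝕜 c x) (hq : AnalyticAt 𝕜 q x) (h : ∀ᶠ t in 𝓝 x, c t ^ 2 = q t ^ 3) :
    AnalyticAt 𝕜 (fun t => c t / q t) x := by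
  by_cases hqx : q x ≠ 0
  · exact hc.div hq hqx
  rw [not_not] at hqx
  have hnorm : ∀ᶠ t in 𝓝 x, √‖q t‖ = ‖c t / q t‖ := by
    filter_upwards [h] with t ht
    rcases eq_or_ne (q t) 0 with h0 | h0
    · simp [h0]
    · rw [Real.sqrt_eq_iff_eq_sq (norm_nonneg _) (norm_nonneg _), ← norm_pow, div_pow, ht,
        pow_succ, mul_div_cancel_left₀ _ (pow_ne_zero 2 h0)]
  refine (hc.meromorphicAt.div hq.meromorphicAt).analyticAt ?_
  rw [ContinuousAt, Pi.div_apply, hqx, div_zero, tendsto_zero_iff_norm_tendsto_zero]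
  have hsqrt : Tendsto (fun t => √‖q t‖) (𝓝 x) (𝓝 (√‖q x‖)) := hq.continuousAt.norm.sqrt
  rw [hqx, norm_zero, Real.sqrt_zero] at hsqrt
  exact hsqrt.congr' hnorm

end RationalParametrization

section DoubleRootCubic

/-- The square `(s - r)²` of the root gap of a cubic with roots `r`, `r`, `s`. -/
def gapSq (P : ℂ[X]) : ℂ := P.coeff 2 ^ 2 - 3 * P.coeff 1

/-- The cube `(s - r)³` of the root gap of a cubic with roots `r`, `r`, `s`. -/
noncomputable def gapCube (P : ℂ[X]) : ℂ :=
  -P.coeff 2 ^ 3 + 9 / 2 * (P.coeff 2 * P.coeff 1) - 27 / 2 * P.coeff 0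

/-- The root gap `s - r` of a cubic with real roots `r`, `r`, `s`; if `s = r` the quotient is
`0 / 0 = 0`, as it should be. -/
noncomputable def rootGap (P : ℂ[X]) : ℝ := (gapCube P).re / (gapSq P).re

/-- The double root `r` of a cubic with real roots `r`, `r`, `s`. -/
noncomputable def doubleRoot (P : ℂ[X]) : ℝ := (-(P.coeff 2).re - rootGap P) / 3

variable {P : ℂ[X]} {r s : ℝ}

theorem coeff_of_double_root (hP : P = (X - C (r : ℂ)) ^ 2 * (X - C (s : ℂ))) :
    P.coeff 2 = -(2 * r + s) ∧ P.coeff 1 = r ^ 2 + 2 * (r * s) ∧ P.coeff 0 = -(r ^ 2 * s) := by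
  rw [hP, sq, Cubic.prod_X_sub_C_eq, Cubic.coeff_eq_b, Cubic.coeff_eq_c, Cubic.coeff_eq_d]
  exact ⟨by ring, by ring, by ring⟩

theorem gapSq_of_double_root (hP : P = (X - C (r : ℂ)) ^ 2 * (X - C (s : ℂ))) :
    gapSq P = ((s - r) ^ 2 : ℝ) := by
  obtain ⟨h2, h1, -⟩ := coeff_of_double_root hP
  rw [gapSq, h2, h1]
  push_cast
  ring

theorem gapCube_of_double_root (hP : P = (X - C (r : ℂ)) ^ 2 * (X - C (s : ℂ))) :
    gapCube P = ((s - r) ^ 3 : ℝ) := by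
  obtain ⟨h2, h1, h0⟩ := coeff_of_double_root hP
  rw [gapCube, h2, h1, h0]
  push_cast
  ring

theorem rootGap_of_double_root (hP : P = (X - C (r : ℂ)) ^ 2 * (X - C (s : ℂ))) :
    rootGap P = s - r := by
  rw [rootGap, gapSq_of_double_root hP, gapCube_of_double_root hP, Complex.ofReal_re,
    Complex.ofReal_re]
  rcases eq_or_ne (s - r) 0 with h | h
  · simp [h]
  · rw [pow_succ, mul_div_cancel_left₀ _ (pow_ne_zero 2 h)]

theorem doubleRoot_of_double_root (hP : P = (X - C (r : ℂ)) ^ 2 * (X - C (s : ℂ))) :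
    doubleRoot P = r := by
  have h2 : P.coeff 2 = ((-(2 * r + s) : ℝ) : ℂ) := by
    rw [(coeff_of_double_root hP).1]; push_cast; rfl
  rw [doubleRoot, rootGap_of_double_root hP, h2, Complex.ofReal_re]
  ring

end DoubleRootCubic

section Taylor

theorem coeff_taylor_of_natDegree_le_two {R : Type*} [Semiring R] {Q : R[X]}
    (hQ : Q.natDegree ≤ 2) (r : R) (k : ℕ) :
    (taylor r Q).coeff k = ∑ i ∈ Finset.range 3, (i + k).choose k * Q.coeff (i + k) * r ^ i := by
  have hlt : (hasseDeriv k Q).natDegree < 3 := by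
    have := natDegree_hasseDeriv_le Q k
    lia
  rw [taylor_coeff, eval_eq_sum_range' hlt]
  simp only [hasseDeriv_coeff]

theorem coeff_taylor_divByMonic_X_sub_C {R : Type*} [CommRing R] (Q : R[X]) (r : R) (k : ℕ) :
    (taylor r (Q /ₘ (X - C r))).coeff k = (taylor r Q).coeff (k + 1) := by
  conv_rhs => rw [← modByMonic_add_div Q (X - C r), modByMonic_X_sub_C_eq_C_eval]
  rw [map_add, taylor_C, taylor_mul, map_sub, taylor_X, taylor_C, add_sub_cancel_right,
    coeff_add, coeff_C_succ, zero_add, coeff_X_mul]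

theorem eval_add_divByMonic_X_sub_C_of_natDegree_le_two {R : Type*} [CommRing R] {Q : R[X]}
    (hQ : Q.natDegree ≤ 2) (r x : R) :
    (Q /ₘ (X - C r)).eval (r + x) = (taylor r Q).coeff 1 + (taylor r Q).coeff 2 * x := by
  have hdeg : (Q /ₘ (X - C r)).natDegree ≤ 2 :=
    (natDegree_divByMonic Q (monic_X_sub_C r)).le.trans (by lia)
  have hcoeff3 : (taylor r Q).coeff 3 = 0 :=
    coeff_eq_zero_of_natDegree_lt (by rw [natDegree_taylor]; lia)
  rw [eval_add_eq_taylor_of_natDegree_le_two hdeg]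
  simp only [coeff_taylor_divByMonic_X_sub_C, zero_add, Nat.reduceAdd, hcoeff3, zero_mul, add_zero]

end Taylor

section HomPart

variable {n : ℕ} (a : Coeffs n)

theorem natDegree_homPart_le (m : ℕ) (t : ℝ) (ξ : Freq n) : (homPart a m t ξ).natDegree ≤ 2 := by
  refine natDegree_sum_le_of_forall_le _ _ fun p hp => natDegree_sum_le_of_forall_le _ _ fun α _ =>
    (natDegree_C_mul_X_pow_le _ _).trans (Nat.lt_succ_iff.1 (Finset.mem_filter.1 hp).2)

theorem coeff_homPart (m j : ℕ) (t : ℝ) (ξ : Freq n) :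
    (homPart a m t ξ).coeff j =
      ∑ p ∈ (Finset.HasAntidiagonal.antidiagonal m).filter (fun p => p.1 < 3),
        ∑ α ∈ Finset.piAntidiag (Finset.univ : Finset (Fin n)) p.2,
          if j = p.1 then a p.1 α t * ∏ i, (ξ i : ℂ) ^ α i else 0 := by
  simp only [homPart, finsetSum_coeff, coeff_C_mul_X_pow]

theorem add_sum_eq_of_mem_antidiagonal {m : ℕ} {p : ℕ × ℕ} {α : Fin n → ℕ}
    (hp : p ∈ (Finset.HasAntidiagonal.antidiagonal m).filter (fun p => p.1 < 3))
    (hα : α ∈ Finset.piAntidiag (Finset.univ : Finset (Fin n)) p.2) : p.1 + ∑ i, α i = m := by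
  rw [(Finset.mem_piAntidiag.1 hα).1]
  exact Finset.HasAntidiagonal.mem_antidiagonal.1 (Finset.mem_filter.1 hp).1

theorem coeff_homPart_smul (m j : ℕ) (t x : ℝ) (ξ : Freq n) :
    (homPart a m t (x • ξ)).coeff j = (x : ℂ) ^ (m - j) * (homPart a m t ξ).coeff j := by
  simp only [coeff_homPart, Finset.mul_sum]
  refine Finset.sum_congr rfl fun p hp => Finset.sum_congr rfl fun α hα => ?_
  split_ifs with hj
  · have hsum : ∑ i, α i = m - j := by
      have := add_sum_eq_of_mem_antidiagonal hp hα
      lia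
    simp only [PiLp.smul_apply, smul_eq_mul, Complex.ofReal_mul, mul_pow, Finset.prod_mul_distrib,
      Finset.prod_pow_eq_pow_sum, hsum]
    ring
  · rw [mul_zero]

theorem exists_polynomial_coeff_homPart_line (m j : ℕ) (t : ℝ) (ξ η : Freq n) :
    ∃ p : ℂ[X], p.natDegree ≤ m - j ∧
      ∀ x : ℝ, (homPart a m t (ξ + x • η)).coeff j = p.eval (x : ℂ) := by
  refine ⟨∑ p ∈ (Finset.HasAntidiagonal.antidiagonal m).filter (fun p => p.1 < 3),
    ∑ α ∈ Finset.piAntidiag (Finset.univ : Finset (Fin n)) p.2,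
      if j = p.1 then C (a p.1 α t) * ∏ i, (C (η i : ℂ) * X + C (ξ i : ℂ)) ^ α i else 0,
    natDegree_sum_le_of_forall_le _ _ fun p hp => natDegree_sum_le_of_forall_le _ _ fun α hα => ?_,
    fun x => ?_⟩
  · split_ifs with hj
    · have hsum : ∑ i, α i = m - j := by
        have := add_sum_eq_of_mem_antidiagonal hp hα
        lia
      rw [← hsum]
      refine (natDegree_C_mul_le _ _).trans ((natDegree_prod_le _ _).trans
        (Finset.sum_le_sum fun i _ => ?_))
      simpa only [mul_one] using natDegree_pow_le_of_le (α i) (natDegree_linear_le (R := ℂ))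
    · exact natDegree_zero.le.trans (Nat.zero_le _)
  · simp only [coeff_homPart, eval_finsetSum]
    refine Finset.sum_congr rfl fun p _ => Finset.sum_congr rfl fun α _ => ?_
    split_ifs
    · simp only [eval_mul, eval_C, eval_prod, eval_pow, eval_add, eval_X, PiLp.add_apply,
        PiLp.smul_apply, smul_eq_mul, Complex.ofReal_add, Complex.ofReal_mul, mul_comm (x : ℂ),
        add_comm (ξ _ : ℂ)]
    · exact eval_zero.symm

theorem analyticOnNhd_coeff_homPart {s : Set ℝ} {m : ℕ}
    (ha : ∀ (j : ℕ) (α : Fin n → ℕ), j < 3 → j + ∑ i, α i = m → AnalyticOnNhd ℝ (a j α) s)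
    (j : ℕ) (ξ : Freq n) : AnalyticOnNhd ℝ (fun t => (homPart a m t ξ).coeff j) s := by
  simp only [coeff_homPart]
  refine Finset.analyticOnNhd_fun_sum _ fun p hp => Finset.analyticOnNhd_fun_sum _ fun α hα => ?_
  split_ifs
  · exact (ha p.1 α (Finset.mem_filter.1 hp).2 (add_sum_eq_of_mem_antidiagonal hp hα)).mul
      analyticOnNhd_const
  · exact analyticOnNhd_const

end HomPart

section AbsoluteValue

theorem abs_eq_abs_of_hasDerivWithinAt_abs {f : ℝ → ℝ} {s : Set ℝ} {x f' d : ℝ}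
    (hs : UniqueDiffWithinAt ℝ s x) (hf : HasDerivWithinAt f f' s x)
    (hd : HasDerivWithinAt (fun y => |f y|) d s x) : |d| = |f'| := by
  rcases eq_or_ne (f x) 0 with hx | hx
  · have : (𝓝[s \ {x}] x).NeBot := by
      rw [← accPt_principal_iff_nhdsWithin]
      exact uniqueDiffWithinAt_iff_accPt.1 hs
    refine tendsto_nhds_unique (hasDerivWithinAt_iff_tendsto_slope.1 hd).abs
      ((hasDerivWithinAt_iff_tendsto_slope.1 hf).abs.congr fun y => ?_)
    simp only [slope_def_field, hx, abs_zero, sub_zero, abs_div, abs_abs]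
  · have hsq : 2 * |f x| * d = 2 * f x * f' := by
      have hd2 := hd.fun_pow 2
      have hf2 := hf.fun_pow 2
      simp only [sq_abs] at hd2
      simpa using hs.eq_deriv _ hd2 hf2
    have := congrArg abs hsq
    simp only [abs_mul, abs_abs, abs_two] at this
    exact mul_left_cancel₀ (by positivity) this

theorem eventually_hasDerivAt_abs {f : ℝ → ℝ} {x : ℝ} (hf : AnalyticAt ℝ f x) :
    ∀ᶠ y in 𝓝[≠] x, ∃ d, |d| = |deriv f y| ∧ HasDerivAt (fun z => |f z|) d y := by
  have hdiff := hf.eventually_analyticAt.filter_mono (nhdsWithin_le_nhds (s := {x}ᶜ))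
  rcases hf.eventually_eq_zero_or_eventually_ne_zero with h0 | hne
  · filter_upwards [h0.eventually_nhds.filter_mono nhdsWithin_le_nhds] with y hy
    have hy' : f =ᶠ[𝓝 y] fun _ => 0 := hy
    refine ⟨0, by rw [hy'.deriv_eq, deriv_const], ?_⟩
    exact (hasDerivAt_const y 0).congr_of_eventuallyEq (hy.mono fun z hz => by simp [hz])
  · filter_upwards [hne, hdiff] with y hy hfy
    have hd := (hfy.differentiableAt.abs hy).hasDerivAt
    exact ⟨_, abs_eq_abs_of_hasDerivWithinAt_abs uniqueDiffWithinAt_univ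
      hfy.differentiableAt.hasDerivAt.hasDerivWithinAt hd.hasDerivWithinAt, hd⟩

theorem le_mul_abs_add_abs_deriv_of_hasDerivWithinAt_abs {f g : ℝ → ℝ} {b c K : ℝ} (hbc : b < c)
    (hf : AnalyticOnNhd ℝ f (Icc b c)) (hg : ContinuousOn g (Icc b c))
    (hK : ∀ x ∈ Icc b c, ∀ d, HasDerivWithinAt (fun y => |f y|) d (Icc b c) x →
      g x ≤ K * (|f x| + |d|)) :
    ∀ x ∈ Icc b c, g x ≤ K * (|f x| + |deriv f x|) := by
  intro x hx
  have : (𝓝[Icc b c \ {x}] x).NeBot := by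
    rw [← accPt_principal_iff_nhdsWithin]
    exact uniqueDiffWithinAt_iff_accPt.1 (uniqueDiffOn_Icc hbc x hx)
  have hle : 𝓝[Icc b c \ {x}] x ≤ 𝓝 x := nhdsWithin_le_nhds
  refine le_of_tendsto_of_tendsto ((hg x hx).mono_left (nhdsWithin_mono x sdiff_subset))
    (((hf x hx).continuousAt.abs.add (hf x hx).deriv.continuousAt.abs).const_mul K |>.mono_left
      hle) ?_
  filter_upwards [self_mem_nhdsWithin, (eventually_hasDerivAt_abs (hf x hx)).filter_mono
    (nhdsWithin_mono x fun y hy => hy.2)] with y hy ⟨d, hd, hderiv⟩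
  refine (hK y hy.1 d hderiv.hasDerivWithinAt).trans_eq ?_
  rw [hd]
  rfl

end AbsoluteValue

section Symbol

variable {n : ℕ} (a : Coeffs n) (t : ℝ)

theorem coeff_symL {j : ℕ} (hj : j < 3) (ξ : Freq n) :
    (symL a t ξ).coeff j = (homPart a 3 t ξ).coeff j := by
  rw [symL, coeff_add, coeff_X_pow, if_neg hj.ne, zero_add]

theorem coeff_symMcheck (j : ℕ) (ξ : Freq n) :
    (symMcheck a t ξ).coeff j = (homPart a 2 t ξ).coeff j -
      1 / 2 * ((homPart (fun j α => deriv (a j α)) 3 t ξ).coeff (j + 1) * (j + 1)) := by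
  rw [symMcheck, symM, symDtL, coeff_sub, coeff_C_mul, coeff_derivative]

theorem natDegree_symMcheck_le (ξ : Freq n) : (symMcheck a t ξ).natDegree ≤ 2 := by
  refine natDegree_sub_le_of_le (natDegree_homPart_le a 2 t ξ) ((natDegree_C_mul_le _ _).trans ?_)
    |>.trans (max_self 2).le
  exact (natDegree_derivative_le _).trans
    ((Nat.sub_le _ _).trans (natDegree_homPart_le (fun j α => deriv (a j α)) 3 t ξ))

theorem coeff_symL_smul {j : ℕ} (hj : j < 3) (x : ℝ) (ξ : Freq n) :
    (symL a t (x • ξ)).coeff j = (x : ℂ) ^ (3 - j) * (symL a t ξ).coeff j := by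
  rw [coeff_symL a t hj, coeff_symL a t hj, coeff_homPart_smul]

theorem coeff_symMcheck_smul (j : ℕ) (x : ℝ) (ξ : Freq n) :
    (symMcheck a t (x • ξ)).coeff j = (x : ℂ) ^ (2 - j) * (symMcheck a t ξ).coeff j := by
  simp only [coeff_symMcheck, coeff_homPart_smul, Nat.reduceSubDiff]
  ring

/-- The gap `τ₃ - τ₁` between the simple and the double root of `L(t,·,ξ)`. -/
noncomputable def gap (ξ : Freq n) : ℝ := rootGap (symL a t ξ)

/-- The vector representing the linear form `ξ ↦ τ₃ - τ₁`. -/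
noncomputable def gapVec : Freq n :=
  ∑ i, gap a t (EuclideanSpace.single i 1) • EuclideanSpace.single i 1

/-- The coefficient of `(τ - τ₁)ᵏ` in the expansion of `M̌(t,τ,ξ)` about the double root `τ₁` of
`L(t,·,ξ)`. -/
noncomputable def mcheckCoeff (k : ℕ) (ξ : Freq n) : ℂ :=
  (taylor (doubleRoot (symL a t ξ) : ℂ) (symMcheck a t ξ)).coeff k

/-- The integrand of the Levi condition (see `IsDoubleRootSymbol.leviM_iff`) without reference to
the roots of `𝓛`. -/
noncomputable def leviDensity (ξ : Freq n) : ℝ :=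
  leviSum (gap a t ξ) (mcheckCoeff a t 0 ξ) (mcheckCoeff a t 1 ξ) (mcheckCoeff a t 2 ξ)

theorem gap_smul (x : ℝ) (ξ : Freq n) : gap a t (x • ξ) = x * gap a t ξ := by
  have hsq : gapSq (symL a t (x • ξ)) = (x ^ 2 : ℝ) * gapSq (symL a t ξ) := by
    simp only [gapSq, coeff_symL_smul a t (Nat.lt_succ_self 2),
      coeff_symL_smul a t (Nat.one_lt_succ_succ 1)]
    push_cast; ring
  have hcube : gapCube (symL a t (x • ξ)) = (x ^ 3 : ℝ) * gapCube (symL a t ξ) := by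
    simp only [gapCube, coeff_symL_smul a t (Nat.lt_succ_self 2),
      coeff_symL_smul a t (Nat.one_lt_succ_succ 1), coeff_symL_smul a t (Nat.succ_pos 2)]
    push_cast; ring
  rw [gap, gap, rootGap, rootGap, hsq, hcube, Complex.re_ofReal_mul, Complex.re_ofReal_mul]
  rcases eq_or_ne x 0 with rfl | hx
  · simp
  · rw [pow_succ x 2, mul_assoc, mul_div_mul_left _ _ (pow_ne_zero 2 hx), mul_div_assoc]

theorem doubleRoot_symL_smul (x : ℝ) (ξ : Freq n) :
    doubleRoot (symL a t (x • ξ)) = x * doubleRoot (symL a t ξ) := by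
  have hgap : rootGap (symL a t (x • ξ)) = x * rootGap (symL a t ξ) := gap_smul a t x ξ
  rw [doubleRoot, doubleRoot, hgap, coeff_symL_smul a t (Nat.lt_succ_self 2), pow_one,
    Complex.re_ofReal_mul]
  ring

theorem mcheckCoeff_smul {k : ℕ} (hk : k ≤ 2) (x : ℝ) (ξ : Freq n) :
    mcheckCoeff a t k (x • ξ) = (x : ℂ) ^ (2 - k) * mcheckCoeff a t k ξ := by
  rw [mcheckCoeff, mcheckCoeff, coeff_taylor_of_natDegree_le_two (natDegree_symMcheck_le a t _),
    coeff_taylor_of_natDegree_le_two (natDegree_symMcheck_le a t _), Finset.mul_sum]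
  refine Finset.sum_congr rfl fun i _ => ?_
  rw [doubleRoot_symL_smul, coeff_symMcheck_smul, Complex.ofReal_mul, mul_pow]
  rcases le_or_gt (i + k) 2 with hik | hik
  · rw [show 2 - k = 2 - (i + k) + i by lia, pow_add]
    ring
  · rw [coeff_eq_zero_of_natDegree_lt ((natDegree_symMcheck_le a t ξ).trans_lt hik)]
    ring

end Symbol

section Reduction

variable {n : ℕ} {T : ℝ} {a : Coeffs n} {τ : Fin 3 → ℝ → Freq n → ℝ} {t : ℝ}

/-- The standing assumptions on the principal symbol: its coefficients and those of the second
order terms are analytic on `[0,T]`, and `L` has real roots `τ₁ = τ₂` and `τ₃`. -/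
structure IsDoubleRootSymbol (T : ℝ) (a : Coeffs n) (τ : Fin 3 → ℝ → Freq n → ℝ) : Prop where
  pos : 0 < T
  analyticOnNhd : ∀ (j : ℕ) (α : Fin n → ℕ), j < 3 → (j + ∑ i, α i = 2 ∨ j + ∑ i, α i = 3) →
    AnalyticOnNhd ℝ (a j α) (Icc 0 T)
  isRootList : ∀ t ∈ Icc 0 T, ∀ ξ : Freq n, IsRootList (symL a t ξ) (fun j => (τ j t ξ : ℂ))
  double : ∀ t ∈ Icc 0 T, ∀ ξ : Freq n, τ 0 t ξ = τ 1 t ξ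

theorem eventuallyEq_of_eqOn_Icc {E : Type*} [NormedAddCommGroup E] [NormedSpace ℝ E]
    {f g : ℝ → E} {b c x : ℝ} (hbc : b < c) (hx : x ∈ Icc b c) (hf : AnalyticAt ℝ f x)
    (hg : AnalyticAt ℝ g x) (h : EqOn f g (Icc b c)) : f =ᶠ[𝓝 x] g := by
  have hacc : AccPt x (𝓟 (Icc b c)) :=
    isPreconnected_Icc.preperfect_of_nontrivial 
      ⟨b, left_mem_Icc.2 hbc.le, c, right_mem_Icc.2 hbc.le, hbc.ne⟩ x hx
  exact (hf.frequently_eq_iff_eventually_eq hg).1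
    ((accPt_iff_frequently_nhdsNE.1 hacc).mono fun s hs => h hs)

namespace IsDoubleRootSymbol

variable (h : IsDoubleRootSymbol T a τ)
include h

theorem symL_eq (ht : t ∈ Icc 0 T) (ξ : Freq n) :
    symL a t ξ = (X - C (τ 0 t ξ : ℂ)) ^ 2 * (X - C (τ 2 t ξ : ℂ)) := by
  have hL := h.isRootList t ht ξ
  rwa [IsRootList, Fin.prod_univ_three, ← h.double t ht ξ, ← sq] at hL

theorem gap_eq (ht : t ∈ Icc 0 T) (ξ : Freq n) : gap a t ξ = τ 2 t ξ - τ 0 t ξ :=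
  rootGap_of_double_root (h.symL_eq ht ξ)

theorem doubleRoot_eq (ht : t ∈ Icc 0 T) (ξ : Freq n) : doubleRoot (symL a t ξ) = τ 0 t ξ :=
  doubleRoot_of_double_root (h.symL_eq ht ξ)

theorem sqrt_disc1_eq (ht : t ∈ Icc 0 T) (ξ : Freq n) : √(disc1 τ t ξ) = |√2 * gap a t ξ| := by
  rw [h.gap_eq ht, ← Real.sqrt_sq_eq_abs, mul_pow, Real.sq_sqrt zero_le_two, disc1,
    ← h.double t ht ξ]
  congr 1
  ring

theorem eval_symMcheck (ht : t ∈ Icc 0 T) (ξ : Freq n) :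
    (symMcheck a t ξ).eval (τ 0 t ξ : ℂ) = mcheckCoeff a t 0 ξ := by
  rw [mcheckCoeff, h.doubleRoot_eq ht, taylor_coeff_zero]

theorem eval_quotQ_zero (ht : t ∈ Icc 0 T) (ξ : Freq n) :
    (quotQ a τ t ξ).eval (τ 0 t ξ : ℂ) = mcheckCoeff a t 1 ξ := by
  simpa only [quotQ, mcheckCoeff, h.doubleRoot_eq ht, add_zero, mul_zero] using
    eval_add_divByMonic_X_sub_C_of_natDegree_le_two (natDegree_symMcheck_le a t ξ) (τ 0 t ξ : ℂ) 0

theorem eval_quotQ_two (ht : t ∈ Icc 0 T) (ξ : Freq n) :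
    (quotQ a τ t ξ).eval (τ 2 t ξ : ℂ) =
      mcheckCoeff a t 1 ξ + mcheckCoeff a t 2 ξ * gap a t ξ := by
  rw [mcheckCoeff, mcheckCoeff, h.doubleRoot_eq ht,
    ← eval_add_divByMonic_X_sub_C_of_natDegree_le_two (natDegree_symMcheck_le a t ξ), ← quotQ,
    h.gap_eq ht, ← Complex.ofReal_add, add_sub_cancel]

theorem gap_add (ht : t ∈ Icc 0 T) (ξ η : Freq n) :
    gap a t (ξ + η) = gap a t ξ + gap a t η := by
  obtain ⟨p₀, -, hp₀⟩ := exists_polynomial_coeff_homPart_line a 3 0 t ξ (η - ξ)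
  obtain ⟨p₁, hdeg₁, hp₁⟩ := exists_polynomial_coeff_homPart_line a 3 1 t ξ (η - ξ)
  obtain ⟨p₂, hdeg₂, hp₂⟩ := exists_polynomial_coeff_homPart_line a 3 2 t ξ (η - ξ)
  have hdeg : (p₂ ^ 2 - C 3 * p₁).natDegree ≤ 2 :=
    (natDegree_sub_le_of_le (natDegree_pow_le_of_le 2 hdeg₂)
      ((natDegree_C_mul_le _ _).trans hdeg₁)).trans (max_self 2).le
  obtain ⟨b, d, hgap⟩ := exists_affine_of_sq_of_cube
    (x := fun x : ℝ => (x : ℂ)) (g := fun x => (gap a t (ξ + x • (η - ξ)) : ℂ))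
    (c := -p₂ ^ 3 + C (9 / 2) * (p₂ * p₁) - C (27 / 2) * p₀)
    (infinite_range_of_injective Complex.ofReal_injective) hdeg
    (fun x => by
      rw [← Complex.ofReal_pow, h.gap_eq ht, ← gapSq_of_double_root (h.symL_eq ht _), gapSq]
      simp only [coeff_symL, Nat.reduceLT, hp₁, hp₂, eval_sub, eval_mul, eval_pow, eval_C])
    (fun x => by
      rw [← Complex.ofReal_pow, h.gap_eq ht, ← gapCube_of_double_root (h.symL_eq ht _), gapCube]
      simp only [coeff_symL, Nat.reduceLT, hp₀, hp₁, hp₂, eval_add, eval_sub, eval_neg, eval_mul,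
        eval_pow, eval_C])
  have hmid : ξ + (1 / 2 : ℝ) • (η - ξ) = (1 / 2 : ℝ) • (ξ + η) := by module
  have h₀ := hgap 0
  have h₁ := hgap 1
  have h₂ := hgap (1 / 2)
  rw [zero_smul, add_zero] at h₀
  rw [one_smul, add_sub_cancel] at h₁
  rw [hmid, gap_smul] at h₂
  push_cast at h₀ h₁ h₂
  exact_mod_cast (by linear_combination 2 * h₂ - h₀ - h₁ :
    (gap a t (ξ + η) : ℂ) = gap a t ξ + gap a t η)

theorem inner_gapVec (ht : t ∈ Icc 0 T) (ξ : Freq n) : inner ℝ ξ (gapVec a t) = gap a t ξ := by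
  let ℓ : Freq n →ₗ[ℝ] ℝ :=
    { toFun := gap a t
      map_add' := h.gap_add ht
      map_smul' := gap_smul a t }
  have hℓ := congrArg ℓ ((EuclideanSpace.basisFun (Fin n) ℝ).sum_repr ξ)
  simp only [map_sum, map_smul, EuclideanSpace.basisFun_apply, EuclideanSpace.basisFun_repr] at hℓ
  simp only [gapVec, inner_sum, inner_smul_right, EuclideanSpace.inner_single_right]
  refine Eq.trans (Finset.sum_congr rfl fun i _ => ?_) hℓ
  simp [ℓ, mul_comm]

theorem analyticOnNhd_coeff_symL {j : ℕ} (hj : j < 3) (ξ : Freq n) :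
    AnalyticOnNhd ℝ (fun t => (symL a t ξ).coeff j) (Icc 0 T) := by
  simp only [coeff_symL _ _ hj]
  exact analyticOnNhd_coeff_homPart a (fun j α hj hα => h.analyticOnNhd j α hj (.inr hα)) j ξ

theorem analyticOnNhd_coeff_symMcheck (j : ℕ) (ξ : Freq n) :
    AnalyticOnNhd ℝ (fun t => (symMcheck a t ξ).coeff j) (Icc 0 T) := by
  simp only [coeff_symMcheck]
  refine (analyticOnNhd_coeff_homPart a (fun j α hj hα => h.analyticOnNhd j α hj (.inl hα)) j
    ξ).sub (analyticOnNhd_const.mul (AnalyticOnNhd.mul ?_ analyticOnNhd_const))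
  exact analyticOnNhd_coeff_homPart _
    (fun j α hj hα => (h.analyticOnNhd j α hj (.inr hα)).deriv) (j + 1) ξ

theorem analyticOnNhd_gap (ξ : Freq n) : AnalyticOnNhd ℝ (fun t => gap a t ξ) (Icc 0 T) := by
  intro t ht
  have h₀ := h.analyticOnNhd_coeff_symL (Nat.succ_pos 2) ξ t ht
  have h₁ := h.analyticOnNhd_coeff_symL (Nat.one_lt_succ_succ 1) ξ t ht
  have h₂ := h.analyticOnNhd_coeff_symL (Nat.lt_succ_self 2) ξ t ht
  have hsq : AnalyticAt ℝ (fun t => (gapSq (symL a t ξ)).re) t :=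
    (Complex.reCLM.analyticAt _).comp ((h₂.pow 2).sub (analyticAt_const.mul h₁))
  have hcube : AnalyticAt ℝ (fun t => (gapCube (symL a t ξ)).re) t :=
    (Complex.reCLM.analyticAt _).comp (((h₂.pow 3).neg.add (analyticAt_const.mul (h₂.mul h₁))).sub
      (analyticAt_const.mul h₀))
  refine analyticAt_div_of_sq_eq_cube hcube hsq
    (eventuallyEq_of_eqOn_Icc h.pos ht (hcube.pow 2) (hsq.pow 3) fun s hs => ?_)
  simp only [gapSq_of_double_root (h.symL_eq hs ξ), gapCube_of_double_root (h.symL_eq hs ξ),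
    Complex.ofReal_re]
  ring

theorem analyticOnNhd_gapVec : AnalyticOnNhd ℝ (gapVec a) (Icc 0 T) :=
  Finset.analyticOnNhd_fun_sum _ fun _ _ => (h.analyticOnNhd_gap _).smul analyticOnNhd_const

theorem analyticOnNhd_mcheckCoeff (k : ℕ) (ξ : Freq n) :
    AnalyticOnNhd ℝ (fun t => mcheckCoeff a t k ξ) (Icc 0 T) := by
  have hroot : AnalyticOnNhd ℝ (fun t => (doubleRoot (symL a t ξ) : ℂ)) (Icc 0 T) :=
    Complex.ofRealCLM.comp_analyticOnNhd (((Complex.reCLM.comp_analyticOnNhd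
      (h.analyticOnNhd_coeff_symL (Nat.lt_succ_self 2) ξ)).neg.sub
        (h.analyticOnNhd_gap ξ)).div analyticOnNhd_const fun _ _ => three_ne_zero)
  simp only [mcheckCoeff, coeff_taylor_of_natDegree_le_two (natDegree_symMcheck_le a _ ξ)]
  exact Finset.analyticOnNhd_fun_sum _ fun i _ =>
    (analyticOnNhd_const.mul (h.analyticOnNhd_coeff_symMcheck _ ξ)).mul (hroot.pow i)

theorem continuousOn_leviDensity (ξ : Freq n) :
    ContinuousOn (fun t => leviDensity a t ξ) (Icc 0 T) :=
  continuousOn_leviSum (h.analyticOnNhd_gap ξ).continuousOn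
    (h.analyticOnNhd_mcheckCoeff 0 ξ).continuousOn (h.analyticOnNhd_mcheckCoeff 1 ξ).continuousOn
    (h.analyticOnNhd_mcheckCoeff 2 ξ).continuousOn

theorem sum_norm_eval_symMcheck_div_eq {lam : Fin 3 → ℝ → Freq n → ℂ}
    (hlam : ∀ t ∈ Icc 0 T, ∀ ξ : Freq n, IsRootList (auxL a t ξ) (fun j => lam j t ξ))
    (ht : t ∈ Icc 0 T) (ξ : Freq n) :
    ∑ j : Fin 3, ‖(symMcheck a t ξ).eval (lam j t ξ)‖ /
      (‖lam j t ξ - lam (j + 1) t ξ‖ * ‖lam j t ξ - lam (j + 2) t ξ‖) = leviDensity a t ξ := by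
  have hL : symL a t ξ =
      (X - C (τ 0 t ξ : ℂ)) ^ 2 * (X - C ((τ 0 t ξ + gap a t ξ : ℝ) : ℂ)) := by
    rw [h.gap_eq ht, add_sub_cancel, h.symL_eq ht]
  rw [sum_norm_eval_div_eq_leviSum hL (natDegree_symMcheck_le a t ξ) (hlam t ht ξ), leviDensity]
  simp only [mcheckCoeff, h.doubleRoot_eq ht]

theorem leviM_iff {lam : Fin 3 → ℝ → Freq n → ℂ}
    (hlam : ∀ t ∈ Icc 0 T, ∀ ξ : Freq n, IsRootList (auxL a t ξ) (fun j => lam j t ξ)) :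
    LeviM T a lam ↔ ∀ R : ℝ, 0 < R → ∃ K : ℝ, 0 < K ∧ ∀ ξ : Freq n, R ≤ ‖ξ‖ →
      ∫ t in (0 : ℝ)..T, leviDensity a t ξ ≤ K * Real.log (1 + ‖ξ‖) := by
  refine forall₂_congr fun R _ => exists_congr fun K => and_congr_right fun _ =>
    forall₂_congr fun ξ _ => ?_
  have heq : EqOn (fun t => leviDensity a t ξ) _ (uIcc 0 T) := fun t ht =>
    (h.sum_norm_eval_symMcheck_div_eq hlam (uIcc_of_le h.pos.le ▸ ht) ξ).symm
  have hcont : ContinuousOn (fun t => leviDensity a t ξ) (uIcc 0 T) := by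
    rw [uIcc_of_le h.pos.le]
    exact h.continuousOn_leviDensity ξ
  rw [and_iff_right (hcont.congr heq.symm).intervalIntegrable, intervalIntegral.integral_congr
    fun t ht => (congrArg abs (heq ht)).symm.trans (abs_of_nonneg (leviSum_nonneg _ _ _ _))]

theorem mcheckVanishes_iff :
    McheckVanishes T a τ ↔ ∀ t ∈ Icc 0 T, ∀ ξ : Freq n, mcheckCoeff a t 0 ξ = 0 :=
  forall₂_congr fun t ht => forall_congr' fun ξ => by rw [h.eval_symMcheck ht]

theorem exists_norm_mcheckCoeff_two_le :
    ∃ K : ℝ, ∀ t ∈ Icc 0 T, ∀ ξ : Freq n, ‖mcheckCoeff a t 2 ξ‖ ≤ K := by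
  obtain ⟨K, hK⟩ := isCompact_Icc.exists_bound_of_continuousOn
    (h.analyticOnNhd_mcheckCoeff 2 0).continuousOn
  refine ⟨K, fun t ht ξ => ?_⟩
  have hzero := mcheckCoeff_smul a t le_rfl 0 ξ
  rw [Nat.sub_self, pow_zero, one_mul, zero_smul] at hzero
  exact hzero ▸ hK t ht

theorem hasDerivWithinAt_sqrt_disc1_iff (ht : t ∈ Icc 0 T) {ξ : Freq n} {d : ℝ} :
    HasDerivWithinAt (fun s => √(disc1 τ s ξ)) d (Icc 0 T) t ↔
      HasDerivWithinAt (fun s => |√2 * gap a s ξ|) d (Icc 0 T) t :=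
  ⟨fun hd => hd.congr (fun _ hs => (h.sqrt_disc1_eq hs ξ).symm) (h.sqrt_disc1_eq ht ξ).symm,
    fun hd => hd.congr (fun _ hs => h.sqrt_disc1_eq hs ξ) (h.sqrt_disc1_eq ht ξ)⟩

theorem qBound_iff :
    QBound T a τ ↔ ∃ K : ℝ, 0 < K ∧ ∀ t ∈ Icc 0 T, ∀ ξ : Freq n,
      ‖mcheckCoeff a t 1 ξ‖ ≤ K * (|gap a t ξ| + |deriv (fun s => gap a s ξ) t|) := by
  constructor
  · rintro ⟨K, hK, hQ⟩
    refine ⟨K * √2, by positivity, fun t ht ξ => ?_⟩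
    have hf : AnalyticOnNhd ℝ (fun s => √2 * gap a s ξ) (Icc 0 T) :=
      analyticOnNhd_const.mul (h.analyticOnNhd_gap ξ)
    have hle := le_mul_abs_add_abs_deriv_of_hasDerivWithinAt_abs h.pos hf
      (h.analyticOnNhd_mcheckCoeff 1 ξ).continuousOn.norm (K := K) (fun s hs d hd => by
        rw [← h.eval_quotQ_zero hs, ← h.sqrt_disc1_eq hs]
        exact hQ 0 (.inl rfl) s hs ξ d ((h.hasDerivWithinAt_sqrt_disc1_iff hs).2 hd)) t ht
    rw [deriv_const_mul_field, abs_mul, abs_mul, abs_of_nonneg (Real.sqrt_nonneg 2), ← mul_add,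
      ← mul_assoc] at hle
    exact hle
  · rintro ⟨K, hK, hm⟩
    obtain ⟨K₂, hK₂⟩ := h.exists_norm_mcheckCoeff_two_le
    refine ⟨K + |K₂|, by positivity, fun j hj t ht ξ d hd => ?_⟩
    have hd' : |d| = √2 * |deriv (fun s => gap a s ξ) t| := by
      rw [abs_eq_abs_of_hasDerivWithinAt_abs (uniqueDiffOn_Icc h.pos t ht)
        (((h.analyticOnNhd_gap ξ t ht).differentiableAt.hasDerivAt.const_mul √2).hasDerivWithinAt)
        ((h.hasDerivWithinAt_sqrt_disc1_iff ht).1 hd), abs_mul, abs_of_nonneg (Real.sqrt_nonneg 2)]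
    have hm₁ : ‖mcheckCoeff a t 1 ξ‖ ≤
        K * (√2 * |gap a t ξ| + √2 * |deriv (fun s => gap a s ξ) t|) := by
      refine (hm t ht ξ).trans ?_
      gcongr <;> exact le_mul_of_one_le_left (abs_nonneg _) (Real.one_le_sqrt.2 one_le_two)
    have hm₂ : ‖mcheckCoeff a t 2 ξ * gap a t ξ‖ ≤
        |K₂| * (√2 * |gap a t ξ| + √2 * |deriv (fun s => gap a s ξ) t|) := by
      rw [norm_mul, Complex.norm_real, Real.norm_eq_abs]
      refine mul_le_mul ((hK₂ t ht ξ).trans (le_abs_self K₂)) ?_ (abs_nonneg _) (abs_nonneg _)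
      exact (le_mul_of_one_le_left (abs_nonneg _) (Real.one_le_sqrt.2 one_le_two)).trans
        (le_add_of_nonneg_right (by positivity))
    rw [h.sqrt_disc1_eq ht, hd', abs_mul, abs_of_nonneg (Real.sqrt_nonneg 2), add_mul]
    rcases hj with rfl | rfl
    · rw [h.eval_quotQ_zero ht]
      exact hm₁.trans (le_add_of_nonneg_right (by positivity))
    · rw [h.eval_quotQ_two ht]
      exact (norm_add_le _ _).trans (add_le_add hm₁ hm₂)

end IsDoubleRootSymbol

end Reduction

section Sufficiency

theorem add_mul_log_one_add_mul_le {A N D R x : ℝ} (hA : 0 ≤ A) (hN : 0 ≤ N) (hD : 0 ≤ D)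
    (hR : 0 < R) (hx : R ≤ x) :
    A + N * Real.log (1 + D * x) ≤
      ((A + N * Real.log (1 + D)) / Real.log (1 + R) + N) * Real.log (1 + x) := by
  have hx₀ : 0 < x := hR.trans_le hx
  have hlogR : 0 < Real.log (1 + R) := Real.log_pos (by linarith)
  have hlogx : Real.log (1 + R) ≤ Real.log (1 + x) := Real.log_le_log (by linarith) (by linarith)
  have hlogD : 0 ≤ Real.log (1 + D) := Real.log_nonneg (by linarith)
  have hsplit : Real.log (1 + D * x) ≤ Real.log (1 + D) + Real.log (1 + x) := by
    rw [← Real.log_mul (by positivity) (by positivity)]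
    exact Real.log_le_log (by positivity) (by nlinarith)
  calc A + N * Real.log (1 + D * x)
      ≤ (A + N * Real.log (1 + D)) * 1 + N * Real.log (1 + x) := by
        linarith [mul_le_mul_of_nonneg_left hsplit hN]
    _ ≤ (A + N * Real.log (1 + D)) * (Real.log (1 + x) / Real.log (1 + R)) +
          N * Real.log (1 + x) := by
        gcongr
        exact (one_le_div hlogR).2 hlogx
    _ = _ := by ring

theorem leviSum_zero_le_of_norm_le {δ δ' K K₂ : ℝ} {m₁ m₂ : ℂ} (hK : 0 ≤ K) (h₂ : ‖m₂‖ ≤ K₂)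
    (h₁ : ‖m₁‖ ≤ K * (|δ| + |δ'|)) :
    leviSum δ 0 m₁ m₂ ≤ 24 * (K₂ + K) + 24 * K * (|δ'| / √(1 + δ ^ 2)) := by
  have hsqrt : √(1 + δ ^ 2) ≤ 1 + |δ| := by
    rw [Real.sqrt_le_left (by positivity), ← sq_abs δ]
    nlinarith [abs_nonneg δ]
  have hquot : ‖m₁‖ / (1 + |δ|) ≤ K * (1 + |δ'| / √(1 + δ ^ 2)) :=
    calc ‖m₁‖ / (1 + |δ|) ≤ K * (|δ| + |δ'|) / (1 + |δ|) := by gcongr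
      _ = K * (|δ| / (1 + |δ|) + |δ'| / (1 + |δ|)) := by ring
      _ ≤ K * (1 + |δ'| / √(1 + δ ^ 2)) := by
        gcongr
        exact div_le_one_of_le₀ (by linarith) (by positivity)
  linarith [leviSum_zero_le δ m₁ m₂]

namespace IsDoubleRootSymbol

variable {n : ℕ} {T : ℝ} {a : Coeffs n} {τ : Fin 3 → ℝ → Freq n → ℝ}
  (h : IsDoubleRootSymbol T a τ)
include h

theorem exists_abs_gap_le :
    ∃ D : ℝ, 0 ≤ D ∧ ∀ t ∈ Icc 0 T, ∀ ξ : Freq n, |gap a t ξ| ≤ D * ‖ξ‖ := by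
  obtain ⟨D, hD⟩ := isCompact_Icc.exists_bound_of_continuousOn h.analyticOnNhd_gapVec.continuousOn
  refine ⟨D, (norm_nonneg _).trans (hD 0 (left_mem_Icc.2 h.pos.le)), fun t ht ξ => ?_⟩
  rw [← h.inner_gapVec ht, mul_comm]
  exact (abs_real_inner_le_norm ξ _).trans
    (mul_le_mul_of_nonneg_left (hD t ht) (norm_nonneg ξ))

theorem arsinhVariation_gap (ξ : Freq n) :
    arsinhVariation (fun t => gap a t ξ) 0 T =
      arsinhVariation (fun t => inner ℝ ξ (gapVec a t)) 0 T := by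
  refine intervalIntegral.integral_congr fun t ht => ?_
  rw [uIcc_of_le h.pos.le] at ht
  have heq : (fun s => gap a s ξ) =ᶠ[𝓝 t] fun s => inner ℝ ξ (gapVec a s) :=
    eventuallyEq_of_eqOn_Icc h.pos ht (h.analyticOnNhd_gap ξ t ht)
      ((innerSL ℝ ξ).comp_analyticOnNhd h.analyticOnNhd_gapVec t ht)
      fun s hs => (h.inner_gapVec hs ξ).symm
  simp only [heq.deriv_eq, h.inner_gapVec ht]

theorem exists_arsinhVariation_gap_le :
    ∃ N D : ℝ, 0 ≤ N ∧ 0 ≤ D ∧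
      ∀ ξ : Freq n, arsinhVariation (fun t => gap a t ξ) 0 T ≤ N * Real.log (1 + D * ‖ξ‖) := by
  obtain ⟨D, hD, hgap⟩ := h.exists_abs_gap_le
  obtain ⟨N, hN, hvar⟩ := exists_arsinhVariation_inner_le h.pos.le h.analyticOnNhd_gapVec
  refine ⟨N, 2 * D, hN, by positivity, fun ξ => ?_⟩
  rw [h.arsinhVariation_gap, mul_assoc]
  exact hvar ξ _ fun t ht => (h.inner_gapVec ht ξ).symm ▸ hgap t ht ξ

theorem leviM_of_mcheckVanishes_of_qBound {lam : Fin 3 → ℝ → Freq n → ℂ}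
    (hlam : ∀ t ∈ Icc 0 T, ∀ ξ : Freq n, IsRootList (auxL a t ξ) (fun j => lam j t ξ))
    (hM : McheckVanishes T a τ) (hQ : QBound T a τ) : LeviM T a lam := by
  rw [h.leviM_iff hlam]
  rw [h.mcheckVanishes_iff] at hM
  obtain ⟨K, hK, hm₁⟩ := h.qBound_iff.1 hQ
  obtain ⟨K₂, hm₂⟩ := h.exists_norm_mcheckCoeff_two_le
  obtain ⟨N, D, hN, hD, hvar⟩ := h.exists_arsinhVariation_gap_le
  have hT := h.pos
  have hK₂ : 0 ≤ K₂ := (norm_nonneg _).trans (hm₂ 0 (left_mem_Icc.2 hT.le) 0)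
  intro R hR
  have hlogR : 0 < Real.log (1 + R) := Real.log_pos (by linarith)
  have hlogD : 0 ≤ Real.log (1 + D) := Real.log_nonneg (by linarith)
  refine ⟨(24 * (K₂ + K) * T + 24 * K * N * Real.log (1 + D)) / Real.log (1 + R) + 24 * K * N,
    by positivity, fun ξ hξ => ?_⟩
  have hint : IntervalIntegrable
      (fun t => |deriv (fun s => gap a s ξ) t| / √(1 + gap a t ξ ^ 2)) volume 0 T :=
    intervalIntegrable_abs_deriv_div_sqrt fun t ht =>
      (h.analyticOnNhd_gap ξ t (uIcc_of_le hT.le ▸ ht)).contDiffAt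
  calc ∫ t in (0 : ℝ)..T, leviDensity a t ξ
      ≤ ∫ t in (0 : ℝ)..T, (24 * (K₂ + K) +
          24 * K * (|deriv (fun s => gap a s ξ) t| / √(1 + gap a t ξ ^ 2))) := by
        refine intervalIntegral.integral_mono_on hT.le
          ((h.continuousOn_leviDensity ξ).intervalIntegrable_of_Icc hT.le)
          (intervalIntegrable_const.add (hint.const_mul _)) fun t ht => ?_
        rw [leviDensity, hM t ht ξ]
        exact leviSum_zero_le_of_norm_le hK.le (hm₂ t ht ξ) (hm₁ t ht ξ)
    _ = 24 * (K₂ + K) * T + 24 * K * arsinhVariation (fun t => gap a t ξ) 0 T := by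
        rw [intervalIntegral.integral_add intervalIntegrable_const (hint.const_mul _),
          intervalIntegral.integral_const, intervalIntegral.integral_const_mul, arsinhVariation,
          smul_eq_mul, sub_zero, mul_comm T]
    _ ≤ 24 * (K₂ + K) * T + 24 * K * N * Real.log (1 + D * ‖ξ‖) := by
        rw [mul_assoc _ N]
        gcongr
        exact hvar ξ
    _ ≤ _ := add_mul_log_one_add_mul_le (by positivity) (by positivity) hD hR hξ

end IsDoubleRootSymbol

end Sufficiency

section VanishingOrder

open Asymptotics

theorem isBigO_of_analyticOrderAt_le {𝕜 E F : Type*} [NontriviallyNormedField 𝕜]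
    [NormedAddCommGroup E] [NormedSpace 𝕜 E] [NormedAddCommGroup F] [NormedSpace 𝕜 F]
    {f : 𝕜 → E} {g : 𝕜 → F} {z : 𝕜} (hf : AnalyticAt 𝕜 f z) (hg : AnalyticAt 𝕜 g z)
    (h : analyticOrderAt g z ≤ analyticOrderAt f z) : f =O[𝓝 z] g := by
  by_cases htop : analyticOrderAt g z = ⊤
  · have hzero : f =ᶠ[𝓝 z] 0 := analyticOrderAt_eq_top.1 (top_le_iff.1 (htop ▸ h))
    exact hzero.trans_isBigO (isBigO_zero _ _)
  · obtain ⟨v, hv, hvz, hgv⟩ := hg.analyticOrderAt_ne_top.1 htop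
    obtain ⟨u, hu, hfu⟩ :=
      (natCast_le_analyticOrderAt hf).1 ((Nat.cast_analyticOrderNatAt htop).trans_le h)
    have hv' : ∀ᶠ x in 𝓝 z, ‖v z‖ / 2 ≤ ‖v x‖ :=
      (hv.continuousAt.norm.eventually_const_lt (half_lt_self (norm_pos_iff.2 hvz))).mono
        fun _ => le_of_lt
    have huv : u =O[𝓝 z] v := (hu.continuousAt.isBigO_one ℝ).trans
      ((isBigO_const_left_iff_pos_le_norm one_ne_zero).2
        ⟨_, half_pos (norm_pos_iff.2 hvz), hv'⟩)
    exact EventuallyEq.trans_isBigO hfu (((isBigO_refl _ _).smul huv).trans_eventuallyEq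
      (EventuallyEq.symm hgv))

theorem isBigO_principal_of_isCompact {X E F : Type*} [TopologicalSpace X] [Norm E]
    [SeminormedAddCommGroup F]
    {f : X → E} {g : X → F} {s : Set X} (hs : IsCompact s) (h : ∀ x ∈ s, f =O[𝓝 x] g) :
    f =O[𝓟 s] g := by
  refine hs.induction_on (p := fun u => f =O[𝓟 u] g) (by simp)
    (fun u v huv hv => hv.mono (principal_mono.2 huv))
    (fun u v hu hv => sup_principal (s := u) (t := v) ▸ hu.sup hv) fun x hx => ?_
  obtain ⟨K, hK⟩ := (h x hx).bound
  exact ⟨_, mem_nhdsWithin_of_mem_nhds hK, IsBigO.of_bound K (mem_principal_self _)⟩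

theorem eventually_mul_log_one_add_pow_lt {c : ℝ} (hc : 0 < c) (K : ℝ) (k : ℕ) :
    ∀ᶠ y : ℝ in atTop, K * Real.log (1 + y ^ k) < c * y := by
  have hlog : (fun y : ℝ => |K| * ((k + 1) * Real.log y)) =o[atTop] id :=
    (Real.isLittleO_log_id_atTop.const_mul_left _).const_mul_left _
  filter_upwards [hlog.bound (half_pos hc), eventually_ge_atTop 2] with y hy hy₂
  have hyk : 1 ≤ y ^ k := one_le_pow₀ (by linarith)
  calc K * Real.log (1 + y ^ k) ≤ |K| * Real.log (y ^ (k + 1)) := by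
        refine mul_le_mul (le_abs_self K) (Real.log_le_log (by positivity) ?_)
          (Real.log_nonneg (by linarith)) (abs_nonneg K)
        rw [pow_succ]
        nlinarith
    _ = |K| * ((k + 1) * Real.log y) := by rw [Real.log_pow, Nat.cast_succ]
    _ ≤ ‖|K| * ((k + 1) * Real.log y)‖ := Real.le_norm_self _
    _ ≤ c / 2 * ‖y‖ := hy
    _ = c / 2 * y := by rw [Real.norm_of_nonneg (by linarith)]
    _ < c * y := by nlinarith

variable {a b t₀ : ℝ}

theorem mul_half_le_integral {F : ℝ → ℝ} {r c : ℝ} (hF : IntervalIntegrable F volume a b)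
    (hF₀ : ∀ t, 0 ≤ F t) (ht₀ : t₀ ∈ Icc a b) (hr : 0 < r) (hrab : r ≤ (b - a) / 2)
    (hc : ∀ t, r / 2 ≤ |t - t₀| → |t - t₀| ≤ r → c ≤ F t) :
    c * (r / 2) ≤ ∫ t in a..b, F t := by
  obtain ⟨α, hα, hβ, hI⟩ : ∃ α, a ≤ α ∧ α + r / 2 ≤ b ∧
      ∀ t ∈ Icc α (α + r / 2), r / 2 ≤ |t - t₀| ∧ |t - t₀| ≤ r := by
    rcases le_total t₀ ((a + b) / 2) with hmid | hmid
    · refine ⟨t₀ + r / 2, by linarith [ht₀.1], by linarith, fun t ht => ?_⟩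
      rw [abs_of_nonneg (by linarith [ht.1])]
      constructor <;> linarith [ht.1, ht.2]
    · refine ⟨t₀ - r, by linarith, by linarith [ht₀.2], fun t ht => ?_⟩
      rw [abs_of_nonpos (by linarith [ht.2])]
      constructor <;> linarith [ht.1, ht.2]
  have hαβ : α ≤ α + r / 2 := by linarith
  have hsub : uIcc α (α + r / 2) ⊆ uIcc a b := by
    rw [uIcc_of_le hαβ, uIcc_of_le (hα.trans (hαβ.trans hβ))]
    exact Icc_subset_Icc hα hβ
  calc c * (r / 2) = ∫ _ in α..(α + r / 2), c := by
        rw [intervalIntegral.integral_const, smul_eq_mul, add_sub_cancel_left, mul_comm]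
    _ ≤ ∫ t in α..(α + r / 2), F t := intervalIntegral.integral_mono_on hαβ
        intervalIntegrable_const (hF.mono_set hsub) fun t ht => hc t (hI t ht).1 (hI t ht).2
    _ ≤ ∫ t in a..b, F t := intervalIntegral.integral_mono_interval hα hαβ hβ
        (Eventually.of_forall hF₀) hF

variable {E : Type*} [NormedAddCommGroup E] {d : ℝ → ℝ} {m : ℝ → E}

theorem continuousOn_mul_norm_div {s : Set ℝ} (hd : ContinuousOn d s) (hm : ContinuousOn m s)
    {x : ℝ} (hx : 0 ≤ x) (c : ℝ) : ContinuousOn (fun t => c * ‖m t‖ / (1 + x * |d t|)) s :=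
  ContinuousOn.div (by fun_prop) (by fun_prop) fun t _ => by positivity

theorem exists_eventually_mul_sq_le_of_isBigO {p : ℕ}
    (hd : d =O[𝓝 t₀] fun t => (t - t₀) ^ (p + 2)) (hm : (fun t => (t - t₀) ^ p) =O[𝓝 t₀] m) :
    ∃ c : ℝ, 0 < c ∧ ∀ᶠ y : ℝ in atTop, ∀ t, y⁻¹ / 2 ≤ |t - t₀| → |t - t₀| ≤ y⁻¹ →
      c * y ^ 2 ≤ y ^ (p + 2) * ‖m t‖ / (1 + y ^ (p + 2) * |d t|) := by
  obtain ⟨A, hA, hdA⟩ := hd.exists_pos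
  obtain ⟨B, hB, hmB⟩ := hm.exists_pos
  obtain ⟨ε, hε, hball⟩ := Metric.eventually_nhds_iff.1 (hdA.bound.and hmB.bound)
  refine ⟨(1 / 2) ^ p / B / (1 + A), by positivity, ?_⟩
  filter_upwards [eventually_gt_atTop ε⁻¹] with y hy t hlow hup
  have hy₀ : 0 < y := (inv_pos.2 hε).trans hy
  obtain ⟨hdt, hmt⟩ := hball (hup.trans_lt (inv_lt_of_inv_lt₀ hε hy))
  rw [norm_pow, Real.norm_eq_abs, Real.norm_eq_abs] at hdt
  rw [norm_pow, Real.norm_eq_abs] at hmt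
  have hden : y ^ (p + 2) * |d t| ≤ A :=
    calc y ^ (p + 2) * |d t| ≤ y ^ (p + 2) * (A * y⁻¹ ^ (p + 2)) := by
          gcongr
          exact hdt.trans (by gcongr)
      _ = A * (y * y⁻¹) ^ (p + 2) := by rw [mul_pow]; ring
      _ = A := by rw [mul_inv_cancel₀ hy₀.ne', one_pow, mul_one]
  have hnum : (1 / 2) ^ p / B * y ^ 2 ≤ y ^ (p + 2) * ‖m t‖ :=
    calc (1 / 2) ^ p / B * y ^ 2 = y ^ (p + 2) * ((y⁻¹ / 2) ^ p / B) := by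
          simp only [div_pow, inv_pow, pow_add, one_pow]
          field_simp
      _ ≤ y ^ (p + 2) * ‖m t‖ := by
          gcongr
          rw [div_le_iff₀' hB]
          exact (pow_le_pow_left₀ (by positivity) hlow p).trans hmt
  calc (1 / 2) ^ p / B / (1 + A) * y ^ 2 = (1 / 2) ^ p / B * y ^ 2 / (1 + A) := by ring
    _ ≤ y ^ (p + 2) * ‖m t‖ / (1 + y ^ (p + 2) * |d t|) := by gcongr

variable [NormedSpace ℝ E]

/- If `m` vanished to order `p` and `d` to order at least `p + 2` at `t₀`, the integral would be at
least a multiple of `y` for `x = y ^ (p + 2)`, as seen on the window `|t - t₀| ∼ 1 / y`. -/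
theorem analyticOrderAt_le_add_one_of_integral_le_log (hab : a < b)
    (hd : AnalyticOnNhd ℝ d (Icc a b)) (hm : AnalyticOnNhd ℝ m (Icc a b)) {K : ℝ}
    (hK : ∀ x : ℝ, 1 ≤ x →
      ∫ t in a..b, x * ‖m t‖ / (1 + x * |d t|) ≤ K * Real.log (1 + x))
    (ht₀ : t₀ ∈ Icc a b) : analyticOrderAt d t₀ ≤ analyticOrderAt m t₀ + 1 := by
  by_contra! hlt
  have htop : analyticOrderAt m t₀ ≠ ⊤ := fun htop => by simp [htop] at hlt
  set p := analyticOrderNatAt m t₀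
  have hp : analyticOrderAt m t₀ = p := (Nat.cast_analyticOrderNatAt htop).symm
  have hmonomial (k : ℕ) : analyticOrderAt (fun t => (t - t₀) ^ k) t₀ = k :=
    analyticOrderAt_centeredMonomial
  have hmonomialAn (k : ℕ) : AnalyticAt ℝ (fun t => (t - t₀) ^ k) t₀ := by fun_prop
  have hdO : d =O[𝓝 t₀] fun t => (t - t₀) ^ (p + 2) := by
    refine isBigO_of_analyticOrderAt_le (hd t₀ ht₀) (hmonomialAn _) ?_
    rw [hmonomial]
    rw [hp] at hlt
    exact Order.add_one_le_of_lt hlt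
  have hmO : (fun t => (t - t₀) ^ p) =O[𝓝 t₀] m :=
    isBigO_of_analyticOrderAt_le (hmonomialAn _) (hm t₀ ht₀) (by rw [hmonomial, hp])
  obtain ⟨c, hc, hlow⟩ := exists_eventually_mul_sq_le_of_isBigO hdO hmO
  obtain ⟨y, hy, hy₁, hyab, hlog⟩ := (hlow.and ((eventually_ge_atTop 1).and
    ((eventually_ge_atTop (2 / (b - a))).and
      (eventually_mul_log_one_add_pow_lt (half_pos hc) K (p + 2))))).exists
  have hy₀ : 0 < y := one_pos.trans_le hy₁
  have hwindow : y⁻¹ ≤ (b - a) / 2 := by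
    rw [← inv_div]
    exact inv_anti₀ (by positivity [sub_pos.2 hab]) hyab
  have hint := mul_half_le_integral
    ((continuousOn_mul_norm_div hd.continuousOn hm.continuousOn (pow_nonneg hy₀.le (p + 2))
      (y ^ (p + 2))).intervalIntegrable_of_Icc hab.le)
    (fun t => by positivity) ht₀ (inv_pos.2 hy₀) hwindow hy
  have hcy : c * y ^ 2 * (y⁻¹ / 2) = c / 2 * y := by field_simp
  linarith [hK (y ^ (p + 2)) (one_le_pow₀ hy₁)]

theorem exists_norm_le_mul_abs_add_abs_deriv_of_integral_le_log (hab : a < b)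
    (hd : AnalyticOnNhd ℝ d (Icc a b)) (hm : AnalyticOnNhd ℝ m (Icc a b)) {K : ℝ}
    (hK : ∀ x : ℝ, 1 ≤ x →
      ∫ t in a..b, x * ‖m t‖ / (1 + x * |d t|) ≤ K * Real.log (1 + x)) :
    ∃ C : ℝ, 0 < C ∧ ∀ t ∈ Icc a b, ‖m t‖ ≤ C * (|d t| + |deriv d t|) := by
  have hO : m =O[𝓟 (Icc a b)] fun t => |d t| + |deriv d t| := by
    refine isBigO_principal_of_isCompact isCompact_Icc fun t₀ ht₀ => ?_
    have hord := analyticOrderAt_le_add_one_of_integral_le_log hab hd hm hK ht₀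
    by_cases hd₀ : d t₀ = 0
    · have hderiv := (hd t₀ ht₀).analyticOrderAt_deriv_add_one
      simp only [hd₀, sub_zero] at hderiv
      rw [← hderiv] at hord
      refine (isBigO_of_analyticOrderAt_le (hm t₀ ht₀) (hd t₀ ht₀).deriv
        (by simpa using hord)).trans (isBigO_of_le _ fun t => ?_)
      rw [Real.norm_eq_abs, Real.norm_of_nonneg (by positivity)]
      exact le_add_of_nonneg_left (abs_nonneg _)
    · refine (isBigO_of_analyticOrderAt_le (hm t₀ ht₀) (hd t₀ ht₀) ?_).trans
        (isBigO_of_le _ fun t => ?_)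
      · rw [(hd t₀ ht₀).analyticOrderAt_eq_zero.2 hd₀]
        exact zero_le
      · rw [Real.norm_eq_abs, Real.norm_of_nonneg (by positivity)]
        exact le_add_of_nonneg_right (abs_nonneg _)
  obtain ⟨C, hC, hbound⟩ := hO.exists_pos
  refine ⟨C, hC, fun t ht => ?_⟩
  have hle : ‖m t‖ ≤ C * ‖|d t| + |deriv d t|‖ := (isBigOWith_principal.1 hbound) t ht
  rwa [Real.norm_of_nonneg (by positivity)] at hle

end VanishingOrder

section Necessity

section Ray

variable {n : ℕ} (a : Coeffs n) (t : ℝ) {x : ℝ} (e : Freq n)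

theorem mul_norm_mcheckCoeff_zero_div_le (hx : 0 < x) :
    x * (x * ‖mcheckCoeff a t 0 e‖) / (1 + x * |gap a t e|) ≤ 7 * leviDensity a t (x • e) := by
  have hle := (norm_le_mul_leviSum (gap a t (x • e)) (mcheckCoeff a t 0 (x • e))
    (mcheckCoeff a t 1 (x • e)) (mcheckCoeff a t 2 (x • e))).1
  rw [← leviDensity, mcheckCoeff_smul a t (Nat.zero_le 2), gap_smul, abs_mul, abs_of_pos hx,
    norm_mul, norm_pow, Complex.norm_of_nonneg hx.le, Nat.sub_zero, sq, mul_assoc] at hle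
  rw [div_le_iff₀ (by positivity)]
  exact hle.trans_eq (by ring)

theorem mul_norm_mcheckCoeff_one_div_le (hx : 0 < x) :
    x * ‖mcheckCoeff a t 1 e‖ / (1 + x * |gap a t e|) ≤ 7 * leviDensity a t (x • e) := by
  have hle := (norm_le_mul_leviSum (gap a t (x • e)) (mcheckCoeff a t 0 (x • e))
    (mcheckCoeff a t 1 (x • e)) (mcheckCoeff a t 2 (x • e))).2
  rw [← leviDensity, mcheckCoeff_smul a t one_le_two, gap_smul, abs_mul, abs_of_pos hx, norm_mul,
    norm_pow, Complex.norm_of_nonneg hx.le, show 2 - 1 = 1 from rfl, pow_one] at hle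
  rw [div_le_iff₀ (by positivity)]
  exact hle.trans_eq (by ring)

end Ray

namespace IsDoubleRootSymbol

variable {n : ℕ} {T : ℝ} {a : Coeffs n} {τ : Fin 3 → ℝ → Freq n → ℝ}
  {lam : Fin 3 → ℝ → Freq n → ℂ} (h : IsDoubleRootSymbol T a τ)
  (hlam : ∀ t ∈ Icc 0 T, ∀ ξ : Freq n, IsRootList (auxL a t ξ) (fun j => lam j t ξ))
  (hL : LeviM T a lam)
include h hlam hL

theorem exists_integral_le_log_of_leviM {e : Freq n} (he : ‖e‖ = 1) :
    ∃ K : ℝ, ∀ x : ℝ, 1 ≤ x → ∀ f : ℝ → ℝ, ContinuousOn f (Icc 0 T) →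
      (∀ t ∈ Icc 0 T, f t ≤ 7 * leviDensity a t (x • e)) →
        ∫ t in (0 : ℝ)..T, f t ≤ K * Real.log (1 + x) := by
  obtain ⟨K, -, hK⟩ := (h.leviM_iff hlam).1 hL 1 one_pos
  refine ⟨7 * K, fun x hx f hf hle => ?_⟩
  have hnorm : ‖x • e‖ = x := by
    rw [norm_smul, he, mul_one, Real.norm_of_nonneg (by linarith)]
  have hKx := hK (x • e) (hnorm.symm ▸ hx)
  rw [hnorm] at hKx
  calc ∫ t in (0 : ℝ)..T, f t ≤ ∫ t in (0 : ℝ)..T, 7 * leviDensity a t (x • e) :=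
        intervalIntegral.integral_mono_on h.pos.le (hf.intervalIntegrable_of_Icc h.pos.le)
          ((continuousOn_const.mul (h.continuousOn_leviDensity _)).intervalIntegrable_of_Icc
            h.pos.le) hle
    _ = 7 * ∫ t in (0 : ℝ)..T, leviDensity a t (x • e) :=
        intervalIntegral.integral_const_mul _ _
    _ ≤ 7 * K * Real.log (1 + x) := by linarith

theorem mcheckCoeff_zero_eq_zero_of_leviM {e : Freq n} (he : ‖e‖ = 1) {t : ℝ}
    (ht : t ∈ Icc 0 T) : mcheckCoeff a t 0 e = 0 := by
  obtain ⟨K, hK⟩ := h.exists_integral_le_log_of_leviM hlam hL he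
  obtain ⟨D, hD, hgap⟩ := h.exists_abs_gap_le
  have hm := h.analyticOnNhd_mcheckCoeff 0 e
  -- The zero function vanishes to infinite order, so comparing with it makes `m₀` vanish.
  have hord := analyticOrderAt_le_add_one_of_integral_le_log (d := 0) (K := (1 + D) * K) h.pos
    analyticOnNhd_const hm (fun x hx => ?_) ht
  · have htop : analyticOrderAt (0 : ℝ → ℝ) t = ⊤ :=
      analyticOrderAt_eq_top.2 (Eventually.of_forall fun _ => rfl)
    rw [htop, top_le_iff, ENat.add_eq_top] at hord
    exact (analyticOrderAt_eq_top.1 (hord.resolve_right ENat.one_ne_top)).self_of_nhds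
  have hx₀ : 0 < x := one_pos.trans_le hx
  have hbound := hK x hx (fun s => (1 + D)⁻¹ * (x * ‖mcheckCoeff a s 0 e‖))
    (by have := hm.continuousOn; fun_prop) fun s hs => by
      refine le_trans ?_ (mul_norm_mcheckCoeff_zero_div_le a s e hx₀)
      have hden : 1 + x * |gap a s e| ≤ x * (1 + D) := by
        have hgap' := hgap s hs e
        rw [he, mul_one] at hgap'
        nlinarith
      calc (1 + D)⁻¹ * (x * ‖mcheckCoeff a s 0 e‖)
          = x * (x * ‖mcheckCoeff a s 0 e‖) / (x * (1 + D)) := by field_simp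
        _ ≤ x * (x * ‖mcheckCoeff a s 0 e‖) / (1 + x * |gap a s e|) := by gcongr
  rw [intervalIntegral.integral_const_mul, inv_mul_le_iff₀ (by positivity)] at hbound
  simpa [mul_assoc] using hbound

theorem mcheckVanishes_of_leviM : McheckVanishes T a τ := by
  refine h.mcheckVanishes_iff.2 fun t ht ξ => ?_
  obtain ⟨x, e, hξ, hzero⟩ :
      ∃ (x : ℝ) (e : Freq n), ξ = x • e ∧ (x = 0 ∨ mcheckCoeff a t 0 e = 0) := by
    rcases eq_or_ne ξ 0 with rfl | hξ
    · exact ⟨0, 0, (zero_smul _ _).symm, .inl rfl⟩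
    · exact ⟨‖ξ‖, ‖ξ‖⁻¹ • ξ, (smul_inv_smul₀ (norm_ne_zero_iff.2 hξ) ξ).symm,
        .inr (h.mcheckCoeff_zero_eq_zero_of_leviM hlam hL (norm_smul_inv_norm hξ) ht)⟩
  rw [hξ, mcheckCoeff_smul a t (Nat.zero_le 2)]
  rcases hzero with rfl | hzero
  · simp
  · rw [hzero, mul_zero]

theorem exists_norm_mcheckCoeff_one_le_of_leviM {e : Freq n} (he : ‖e‖ = 1) :
    ∃ C : ℝ, 0 < C ∧ ∀ t ∈ Icc 0 T, ‖mcheckCoeff a t 1 e‖ ≤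
      C * (|gap a t e| + |deriv (fun s => gap a s e) t|) := by
  obtain ⟨K, hK⟩ := h.exists_integral_le_log_of_leviM hlam hL he
  have hd := h.analyticOnNhd_gap e
  have hm := h.analyticOnNhd_mcheckCoeff 1 e
  exact exists_norm_le_mul_abs_add_abs_deriv_of_integral_le_log h.pos hd hm fun x hx =>
    hK x hx _ (continuousOn_mul_norm_div hd.continuousOn hm.continuousOn (by linarith) x)
      fun t _ => mul_norm_mcheckCoeff_one_div_le a t e (by linarith)

theorem qBound_of_leviM (hn : n = 1) : QBound T a τ := by
  subst hn
  have he : ‖(EuclideanSpace.single 0 1 : Freq 1)‖ = 1 := by simp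
  obtain ⟨C, hC, hbound⟩ := h.exists_norm_mcheckCoeff_one_le_of_leviM hlam hL he
  refine h.qBound_iff.2 ⟨C, hC, fun t ht ξ => ?_⟩
  obtain ⟨x, rfl⟩ : ∃ x : ℝ, ξ = x • EuclideanSpace.single 0 1 :=
    ⟨ξ 0, by ext i; fin_cases i; simp⟩
  have hx := mul_le_mul_of_nonneg_left (hbound t ht) (abs_nonneg x)
  simp only [gap_smul, deriv_const_mul_field, abs_mul]
  rw [mcheckCoeff_smul a t one_le_two, show 2 - 1 = 1 from rfl, pow_one, norm_mul,
    Complex.norm_real, Real.norm_eq_abs, ← mul_add, mul_left_comm C]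
  exact hx

end IsDoubleRootSymbol

end Necessity

end ThirdOrder

theorem mainTheorem11_general {n : ℕ} {T : ℝ} (hT : 0 < T)
    (a : ThirdOrder.Coeffs n)
    (ha : ∀ (j : ℕ) (α : Fin n → ℕ), j < 3 → (j + ∑ i, α i = 2 ∨ j + ∑ i, α i = 3) →
      AnalyticOnNhd ℝ (a j α) (Set.Icc 0 T))
    (τ : Fin 3 → ℝ → ThirdOrder.Freq n → ℝ)
    (hτ : ∀ t ∈ Set.Icc 0 T, ∀ ξ : ThirdOrder.Freq n,
      ThirdOrder.IsRootList (ThirdOrder.symL a t ξ) (fun j => (τ j t ξ : ℂ)))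
    (hτ12 : ∀ t ∈ Set.Icc 0 T, ∀ ξ : ThirdOrder.Freq n, τ 0 t ξ = τ 1 t ξ)
    (lam : Fin 3 → ℝ → ThirdOrder.Freq n → ℂ)
    (hlam : ∀ t ∈ Set.Icc 0 T, ∀ ξ : ThirdOrder.Freq n,
      ThirdOrder.IsRootList (ThirdOrder.auxL a t ξ) (fun j => lam j t ξ)) :
    (ThirdOrder.McheckVanishes T a τ ∧ ThirdOrder.QBound T a τ → ThirdOrder.LeviM T a lam) ∧
    (ThirdOrder.LeviM T a lam →
      ThirdOrder.McheckVanishes T a τ ∧ (n = 1 → ThirdOrder.QBound T a τ)) := by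
  have h : ThirdOrder.IsDoubleRootSymbol T a τ := ⟨hT, ha, hτ, hτ12⟩
  exact ⟨fun ⟨hM, hQ⟩ => h.leviM_of_mcheckVanishes_of_qBound hlam hM hQ,
    fun hL => ⟨h.mcheckVanishes_of_leviM hlam hL, h.qBound_of_leviM hlam hL⟩⟩

theorem mainTheorem11 {n : ℕ} {T : ℝ} (hT : 0 < T)
    (a : ThirdOrder.Coeffs n)
    (ha : ∀ (j : ℕ) (α : Fin n → ℕ), j < 3 → (j + ∑ i, α i = 2 ∨ j + ∑ i, α i = 3) →
      AnalyticOnNhd ℝ (a j α) (Set.Icc 0 T))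
    (τ : Fin 3 → ℝ → ThirdOrder.Freq n → ℝ)
    (hτ : ∀ t ∈ Set.Icc 0 T, ∀ ξ : ThirdOrder.Freq n,
      ThirdOrder.IsRootList (ThirdOrder.symL a t ξ) (fun j => (τ j t ξ : ℂ)))
    (hτ12 : ∀ t ∈ Set.Icc 0 T, ∀ ξ : ThirdOrder.Freq n, τ 0 t ξ = τ 1 t ξ)
    (hτ13 : ∃ t ∈ Set.Icc 0 T, ∃ ξ : ThirdOrder.Freq n, τ 2 t ξ ≠ τ 0 t ξ)
    (lam : Fin 3 → ℝ → ThirdOrder.Freq n → ℂ)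
    (hlam : ∀ t ∈ Set.Icc 0 T, ∀ ξ : ThirdOrder.Freq n,
      ThirdOrder.IsRootList (ThirdOrder.auxL a t ξ) (fun j => lam j t ξ)) :
    (ThirdOrder.McheckVanishes T a τ ∧ ThirdOrder.QBound T a τ → ThirdOrder.LeviM T a lam) ∧
    (n = 1 → ThirdOrder.LeviM T a lam →
      ThirdOrder.McheckVanishes T a τ ∧ ThirdOrder.QBound T a τ) := by
  obtain ⟨hsuff, hnec⟩ := mainTheorem11_general hT a ha τ hτ hτ12 lam hlam
  exact ⟨hsuff, fun hn hL => (hnec hL).imp_right fun hQ => hQ hn⟩
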